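/- For real $s\ge 2$ and $\beta>0$ let $x_0=x_0(s,\beta)$ be the positive root of $1-x^2-(x/\beta)^{s-1}=0$, let $$\varphi_0(s,\beta)=\int_0^{x_0}\frac{dy}{\sqrt{1-y^2-(y/\beta)^{s-1}}},$$ and let $\theta=\pi-2\varphi_0(s,\beta)\in(0,\pi)$ be the deviation angle. Denote by $\theta\mapsto\beta(\theta)$ the inverse function of $\beta\mapsto\theta$, and define the angular part of the inverse power law collision kernel by $$b_s(\cos\theta)=2^{4/(s-1)}\,\frac{\beta(\theta)}{\sin\theta}\,|\beta'(\theta)|,\qquad \theta\in(0,\pi).$$ For $\xi>0$ let $h(\zeta,\xi)=2\zeta+\xi(1-e^{-\zeta})$ and $$\psi_\infty(\xi)=2\xi\int_0^\infty\frac{1-e^{-\zeta}}{\sqrt{2\zeta}\,\sqrt{h(\zeta,\xi)}\,\bigl(\sqrt{2\zeta}+\sqrt{h(\zeta,\xi)}\bigr)}\,d\zeta .$$ Theorem. The map $\psi_\infty:(0,\infty)\to(0,\infty)$ is a bijection. Let $\xi_\infty=\psi_\infty^{-1}$ be its inverse, and put $$\Phi(\psi)=\frac{\xi_\infty'(\psi)}{\xi_\infty(\psi)\,\psi}+\frac{\xi_\infty'(\psi)}{2\psi},\qquad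 \psi>0.$$ Then $$\lim_{s\to\infty}b_s\!\left(\cos\left(\frac{\psi}{\sqrt s}\right)\right)=\Phi(\psi)$$ locally uniformly for $\psi\in(0,\infty)$. The function $\Phi:(0,\infty)\to\mathbb R$ is real analytic and satisfies $\lim_{\psi\to\infty}\Phi(\psi)=\tfrac14$. Furthermore, $$\Phi(\psi)=\frac1{\psi^2}+\frac1{\sqrt\pi}\,\frac1\psi+\Phi_0(\psi),\qquad \psi>0,$$ where $\Phi_0:[0,\infty)\to\mathbb R$ is continuous. -/

import Mathlib

open Set Filter Topology MeasureTheory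

noncomputable section

namespace InversePowerLaw

/-- For the inverse power potential `r ^ (-(s - 1))` and the dimensionless impact parameter
`β > 0`: the positive root `x₀` of `1 - x² - (x / β) ^ (s - 1) = 0`.  (For `s > 1` the set below
has exactly one element.)  Physically `x₀` is the impact parameter divided by the distance of
closest approach. -/
def turningPoint (s β : ℝ) : ℝ :=
  sSup {x : ℝ | 0 < x ∧ 1 - x ^ 2 - (x / β) ^ (s - 1) = 0}

/-- The angle `φ₀` of the axis of symmetry of the orbit with impact parameter `β`. -/
def apseAngle (s β : ℝ) : ℝ :=
  ∫ y in (0 : ℝ)..turningPoint s β, 1 / √(1 - y ^ 2 - (y / β) ^ (s - 1))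

/-- The deviation angle `θ = π - 2 φ₀` of the orbit with impact parameter `β`. -/
def deviationAngle (s β : ℝ) : ℝ := Real.pi - 2 * apseAngle s β

/-- The impact parameter `β(θ)` as a function of the deviation angle `θ ∈ (0, π)`: the inverse of
`β ↦ θ` on `(0, ∞)`. -/
def impactParameter (s : ℝ) : ℝ → ℝ := Function.invFunOn (deviationAngle s) (Ioi 0)

/-- The angular part `b_s` of the collision kernel, as a function of `c = cos θ`, `θ ∈ (0, π)`:
`b_s(cos θ) = 2 ^ (4 / (s - 1)) * β(θ) / sin θ * |β'(θ)|`. -/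
def angularPart (s c : ℝ) : ℝ :=
  2 ^ (4 / (s - 1)) * (impactParameter s (Real.arccos c) / Real.sin (Real.arccos c)) *
    |deriv (impactParameter s) (Real.arccos c)|

/-- `h(ζ, ξ) = 2ζ + ξ (1 - e^{-ζ})`. -/
def hFun (ζ ξ : ℝ) : ℝ := 2 * ζ + ξ * (1 - Real.exp (-ζ))

/-- The explicit integral `ψ_∞(ξ)`. -/
def psiInf (ξ : ℝ) : ℝ :=
  2 * ξ * ∫ ζ in Ioi (0 : ℝ), (1 - Real.exp (-ζ)) /
    (√(2 * ζ) * √(hFun ζ ξ) * (√(2 * ζ) + √(hFun ζ ξ)))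

/-- The inverse `ξ_∞` of `ψ_∞` on `(0, ∞)`. -/
def xiInf : ℝ → ℝ := Function.invFunOn psiInf (Ioi 0)

/-- The limit profile `Φ(ψ) = ξ_∞'(ψ) / (ξ_∞(ψ) ψ) + ξ_∞'(ψ) / (2 ψ)`. -/
def limitProfile (ψ : ℝ) : ℝ :=
  deriv xiInf ψ / (xiInf ψ * ψ) + deriv xiInf ψ / (2 * ψ)

end InversePowerLaw

end

noncomputable section

namespace InversePowerLaw

/-! Put ε = 1/(s - 1) and parametrise orbits by x > 0 instead of β, with turning point x₀ = (1 +
εx)^(-1/2). The equation for x₀ then gives β explicitly (`scaledImpact`), and the substitution y =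
x₀ e^{-εζ} turns φ₀ into ∫ √ε e^{-εζ} / √(g + x(1 - e^{-ζ})) dζ, where g = (1 - e^{-2εζ})/ε. At x =
0 the same integral equals π/2, so π - 2φ₀ is a difference of two integrals over (0, ∞), and θ = √ε
· T_ε(x) with T_ε = `scaledAngle ε`. As ε → 0, g → 2ζ and T_ε tends to ψ_∞ (`tendsto_scaledAngle`).

T_ε and ψ_∞ are both of the form `angleIntegral W ρ`, with integrable W > 0 and 0 < ρ ≤ 1/2. Such a
function extends holomorphically to Re z > -2 and is strictly increasing on [0, ∞), with derivative
∫ W (1 + xρ)^(-3/2). This gives analyticity and invertibility for both at once.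

In the parameter x the kernel is explicit (`angularPart_eq`): the factor ε in dβ/dx cancels the two
factors √ε from sin θ and dθ/dx. Since β → 1, the limit is (1/x + 1/2) / (ψ_∞ ψ_∞') at x = ξ_∞(ψ),
which is Φ(ψ). All limits are taken jointly in s → ∞ and ψ → ψ₀; with continuity of Φ this is
locally uniform convergence.

The behaviour of Φ is read off the same formula. For large x, scaling ζ = xt gives ψ_∞ ~ 2√x and
ψ_∞' ~ 1/√x, whence 1/4. Near x = 0, ψ_∞ is analytic with ψ_∞'(0) = √(π/2) and ψ_∞''(0) = -√π (1 -
1/√2), and these two values produce exactly the singular terms 1/ψ² and 1/(√π ψ). -/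

/-! ### Holomorphic dependence of angle integrals on the parameter -/

theorem cpow_half_sq (w : ℂ) : (w ^ (2⁻¹ : ℂ)) ^ 2 = w := by
  simpa only [Nat.cast_ofNat] using Complex.cpow_nat_inv_pow w two_ne_zero

theorem cpow_half_re_nonneg (w : ℂ) : 0 ≤ (w ^ (2⁻¹ : ℂ)).re := by
  by_cases hw : w = 0
  · simp [hw]
  rw [Complex.cpow_def_of_ne_zero hw, Complex.exp_re]
  refine mul_nonneg (Real.exp_pos _).le ?_
  have h1 : (Complex.log w * 2⁻¹).im = w.arg / 2 := by
    have : (2⁻¹ : ℂ) = ((2⁻¹ : ℝ) : ℂ) := by norm_num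
    rw [this, Complex.im_mul_ofReal, Complex.log_im]
    ring
  rw [h1]
  exact Real.cos_nonneg_of_neg_pi_div_two_le_of_le
    (by linarith [Complex.neg_pi_lt_arg w]) (by linarith [Complex.arg_le_pi w])

/-- The principal square root of `1 + z ρ`. -/
def rootFactor (z : ℂ) (ρ : ℝ) : ℂ := (1 + z * ρ) ^ (2⁻¹ : ℂ)

theorem rootFactor_sq (z : ℂ) (ρ : ℝ) : rootFactor z ρ ^ 2 = 1 + z * ρ := cpow_half_sq _

theorem measurable_rootFactor (z : ℂ) : Measurable (rootFactor z) := by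
  unfold rootFactor
  fun_prop

theorem rootFactor_ofReal {x ρ : ℝ} (h : 0 ≤ 1 + x * ρ) :
    rootFactor x ρ = (√(1 + x * ρ) : ℝ) := by
  rw [rootFactor, Real.sqrt_eq_rpow, Complex.ofReal_cpow h]
  norm_num

/-- Because ρ ≤ 1/2, the half-plane Re z > -2 is mapped by z ↦ 1 + zρ into the open right
half-plane. The bound is uniform in ρ and keeps the root away from its branch cut and from zero. -/
theorem re_one_add_ge {c ρ : ℝ} {z : ℂ} (hz : c ≤ z.re) (h0 : 0 < ρ)
    (h1 : ρ ≤ 1 / 2) : min 1 (1 + c / 2) ≤ (1 + z * ρ).re := by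
  have : (1 + z * ρ).re = 1 + z.re * ρ := by simp
  rw [this]
  rcases le_total 0 c with h | h
  · exact (min_le_left _ _).trans (by nlinarith)
  · exact (min_le_right _ _).trans (by nlinarith)

theorem norm_rootFactor_ge {c ρ : ℝ} {z : ℂ} (hz : c ≤ z.re) (h0 : 0 < ρ)
    (h1 : ρ ≤ 1 / 2) : √(min 1 (1 + c / 2)) ≤ ‖rootFactor z ρ‖ := by
  rw [Real.sqrt_le_left (norm_nonneg _), ← norm_pow, rootFactor_sq]
  exact (re_one_add_ge hz h0 h1).trans (Complex.re_le_norm _)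

theorem one_le_norm_one_add_rootFactor (z : ℂ) (ρ : ℝ) : 1 ≤ ‖1 + rootFactor z ρ‖ := by
  refine le_trans ?_ (Complex.re_le_norm _)
  have := cpow_half_re_nonneg (1 + z * ρ)
  simp only [Complex.add_re, Complex.one_re, rootFactor]
  linarith

theorem sqrt_min_pos {c : ℝ} (hc : -2 < c) : 0 < √(min 1 (1 + c / 2)) :=
  Real.sqrt_pos.2 (lt_min one_pos (by linarith))

theorem rootFactor_ne_zero {ρ : ℝ} {z : ℂ} (hz : -2 < z.re) (h0 : 0 < ρ) (h1 : ρ ≤ 1 / 2) :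
    rootFactor z ρ ≠ 0 := by
  rw [← norm_pos_iff]
  exact (sqrt_min_pos hz).trans_le (norm_rootFactor_ge le_rfl h0 h1)

theorem one_add_rootFactor_ne_zero (z : ℂ) (ρ : ℝ) : 1 + rootFactor z ρ ≠ 0 := by
  rw [← norm_pos_iff]
  exact one_pos.trans_le (one_le_norm_one_add_rootFactor z ρ)

theorem hasDerivAt_rootFactor {ρ : ℝ} {z : ℂ} (hz : -2 < z.re) (h0 : 0 < ρ) (h1 : ρ ≤ 1 / 2) :
    HasDerivAt (rootFactor · ρ) (ρ / (2 * rootFactor z ρ)) z := by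
  have hs : (1 + z * ρ) ∈ Complex.slitPlane := Or.inl
    ((lt_min one_pos (by linarith)).trans_le (re_one_add_ge le_rfl h0 h1))
  have h := ((((hasDerivAt_id z).mul_const (ρ : ℂ)).const_add 1).cpow_const
    (c := (2⁻¹ : ℂ)) (by simpa using hs))
  have hne := rootFactor_ne_zero hz h0 h1
  refine h.congr_deriv ?_
  have h2 : (2⁻¹ : ℂ) - 1 = -2⁻¹ := by norm_num
  simp only [id, h2, Complex.cpow_neg]
  change 2⁻¹ * (rootFactor z ρ)⁻¹ * _ = _
  field_simp

/-- With t² = 1 + zρ the function equals 2(1 - 1/t)/ρ, whose derivative is visibly t⁻³. The form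
used here avoids dividing by ρ. -/
theorem hasDerivAt_two_mul_div {ρ : ℝ} {z : ℂ} (hz : -2 < z.re) (h0 : 0 < ρ) (h1 : ρ ≤ 1 / 2) :
    HasDerivAt (fun z : ℂ => 2 * z / (rootFactor z ρ * (1 + rootFactor z ρ)))
      (1 / rootFactor z ρ ^ 3) z := by
  have hne := rootFactor_ne_zero hz h0 h1
  have hne1 := one_add_rootFactor_ne_zero z ρ
  have ht := hasDerivAt_rootFactor hz h0 h1
  have h := ((hasDerivAt_id z).const_mul (2 : ℂ)).div (ht.mul (ht.const_add 1))
    (mul_ne_zero hne hne1)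
  refine h.congr_deriv ?_
  have hsq := rootFactor_sq z ρ
  simp only [id, Pi.mul_apply]
  generalize rootFactor z ρ = t at *
  field_simp
  have : (ρ : ℂ) * z = t ^ 2 - 1 := by rw [hsq]; ring
  linear_combination -(1 + 2 * t) * this

theorem hasDerivAt_inv_cube {ρ : ℝ} {z : ℂ} (hz : -2 < z.re) (h0 : 0 < ρ) (h1 : ρ ≤ 1 / 2) :
    HasDerivAt (fun z : ℂ => 1 / rootFactor z ρ ^ 3)
      (-(3 / 2) * ρ / rootFactor z ρ ^ 5) z := by
  have hne := rootFactor_ne_zero hz h0 h1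
  have ht := hasDerivAt_rootFactor hz h0 h1
  have h := ((ht.pow 3).inv (pow_ne_zero 3 hne))
  simp only [one_div]
  refine h.congr_deriv ?_
  simp only [Pi.pow_apply]
  generalize rootFactor z ρ = t at *
  field_simp
  push_cast
  ring

/-- Differentiation under the integral: on a smaller half-plane Re z > c > -2 the derivative is
dominated by a constant multiple of |W|. Stated for a general kernel because it is used for both the
first and the second derivative. -/
theorem hasDerivAt_weighted_integral {W ρ : ℝ → ℝ} (hW : IntegrableOn W (Ioi 0))
    (hρm : Measurable ρ) (hρ : ∀ ζ, 0 < ζ → 0 < ρ ζ ∧ ρ ζ ≤ 1 / 2) {K K' : ℂ → ℝ → ℂ}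
    (hKm : ∀ z, Measurable (K z)) (hKm' : ∀ z, Measurable (K' z))
    (hd : ∀ z : ℂ, -2 < z.re → ∀ r : ℝ, 0 < r → r ≤ 1 / 2 → HasDerivAt (K · r) (K' z r) z)
    (hb : ∀ z : ℂ, -2 < z.re → ∃ C, ∀ r : ℝ, 0 < r → r ≤ 1 / 2 → ‖K z r‖ ≤ C)
    (hb' : ∀ c : ℝ, -2 < c → ∃ C, ∀ z : ℂ, c ≤ z.re → ∀ r : ℝ, 0 < r → r ≤ 1 / 2 → ‖K' z r‖ ≤ C)
    {z : ℂ} (hz : -2 < z.re) :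
    HasDerivAt (fun z => ∫ ζ in Ioi (0 : ℝ), (W ζ : ℂ) * K z (ρ ζ))
      (∫ ζ in Ioi (0 : ℝ), (W ζ : ℂ) * K' z (ρ ζ)) z := by
  obtain ⟨c, hc, hcz⟩ := exists_between hz
  obtain ⟨C', hC'⟩ := hb' c hc
  obtain ⟨C, hC⟩ := hb z hz
  have hWm : AEStronglyMeasurable (fun ζ => (W ζ : ℂ)) (volume.restrict (Ioi 0)) :=
    Complex.continuous_ofReal.comp_aestronglyMeasurable hW.aestronglyMeasurable
  have hWn : Integrable (fun ζ => ‖W ζ‖) (volume.restrict (Ioi 0)) := hW.norm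
  refine (hasDerivAt_integral_of_dominated_loc_of_deriv_le (s := {w : ℂ | c < w.re})
    (bound := fun ζ => C' * ‖W ζ‖)
    (F := fun w ζ => (W ζ : ℂ) * K w (ρ ζ)) (F' := fun w ζ => (W ζ : ℂ) * K' w (ρ ζ))
    ?_ ?_ ?_ ?_ ?_ ?_ ?_).2
  · exact (isOpen_lt continuous_const Complex.continuous_re).mem_nhds hcz
  · exact Eventually.of_forall fun w => hWm.mul ((hKm w).comp hρm).aestronglyMeasurable
  · refine Integrable.mono' (hWn.const_mul C)
      (hWm.mul ((hKm z).comp hρm).aestronglyMeasurable) ?_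
    filter_upwards [ae_restrict_mem measurableSet_Ioi] with ζ hζ
    rw [norm_mul, Complex.norm_real, mul_comm]
    gcongr
    exact hC _ (hρ ζ hζ).1 (hρ ζ hζ).2
  · exact hWm.mul ((hKm' z).comp hρm).aestronglyMeasurable
  · filter_upwards [ae_restrict_mem measurableSet_Ioi] with ζ hζ w hw
    rw [norm_mul, Complex.norm_real, mul_comm]
    gcongr
    exact hC' w (le_of_lt hw) _ (hρ ζ hζ).1 (hρ ζ hζ).2
  · exact hWn.const_mul C'
  · filter_upwards [ae_restrict_mem measurableSet_Ioi] with ζ hζ w hw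
    exact (hd w (hc.trans hw) _ (hρ ζ hζ).1 (hρ ζ hζ).2).const_mul _

section Weighted

variable {W ρ : ℝ → ℝ}

theorem norm_inv_rootFactor_pow_le {c r : ℝ} {z : ℂ} (hc : -2 < c) (hz : c ≤ z.re) (h0 : 0 < r)
    (h1 : r ≤ 1 / 2) (k : ℕ) : ‖(rootFactor z r ^ k)⁻¹‖ ≤ (√(min 1 (1 + c / 2)) ^ k)⁻¹ := by
  rw [norm_inv, norm_pow]
  have := sqrt_min_pos hc
  gcongr
  exact norm_rootFactor_ge hz h0 h1

theorem hasDerivAt_complex_integral (hW : IntegrableOn W (Ioi 0)) (hρm : Measurable ρ)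
    (hρ : ∀ ζ, 0 < ζ → 0 < ρ ζ ∧ ρ ζ ≤ 1 / 2) {z : ℂ} (hz : -2 < z.re) :
    HasDerivAt (fun z : ℂ => ∫ ζ in Ioi (0 : ℝ),
        (W ζ : ℂ) * (2 * z / (rootFactor z (ρ ζ) * (1 + rootFactor z (ρ ζ)))))
      (∫ ζ in Ioi (0 : ℝ), (W ζ : ℂ) * (1 / rootFactor z (ρ ζ) ^ 3)) z := by
  refine hasDerivAt_weighted_integral (K := fun z r => 2 * z / (rootFactor z r *
    (1 + rootFactor z r))) (K' := fun z r => 1 / rootFactor z r ^ 3) hW hρm hρ ?_ ?_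
    (fun z hz r h0 h1 => hasDerivAt_two_mul_div hz h0 h1) ?_ ?_ hz
  · intro z
    have := measurable_rootFactor z
    fun_prop
  · intro z
    have := measurable_rootFactor z
    fun_prop
  · intro z hz
    refine ⟨‖2 * z‖ * ((√(min 1 (1 + z.re / 2)) ^ 1)⁻¹ * 1), fun r h0 h1 => ?_⟩
    rw [div_eq_mul_inv, mul_inv, norm_mul, norm_mul (rootFactor z r)⁻¹]
    gcongr
    · simpa using norm_inv_rootFactor_pow_le hz le_rfl h0 h1 1
    · rw [norm_inv]
      exact inv_le_one_of_one_le₀ (one_le_norm_one_add_rootFactor z r)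
  · intro c hc
    refine ⟨(√(min 1 (1 + c / 2)) ^ 3)⁻¹, fun z hz r h0 h1 => ?_⟩
    rw [one_div]
    exact norm_inv_rootFactor_pow_le hc hz h0 h1 3

theorem hasDerivAt_complex_integral_deriv (hW : IntegrableOn W (Ioi 0)) (hρm : Measurable ρ)
    (hρ : ∀ ζ, 0 < ζ → 0 < ρ ζ ∧ ρ ζ ≤ 1 / 2) {z : ℂ} (hz : -2 < z.re) :
    HasDerivAt (fun z : ℂ => ∫ ζ in Ioi (0 : ℝ), (W ζ : ℂ) * (1 / rootFactor z (ρ ζ) ^ 3))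
      (∫ ζ in Ioi (0 : ℝ), (W ζ : ℂ) * (-(3 / 2) * ρ ζ / rootFactor z (ρ ζ) ^ 5)) z := by
  refine hasDerivAt_weighted_integral (K := fun z r => 1 / rootFactor z r ^ 3)
    (K' := fun z r => -(3 / 2) * r / rootFactor z r ^ 5) hW hρm hρ ?_ ?_
    (fun z hz r h0 h1 => hasDerivAt_inv_cube hz h0 h1) ?_ ?_ hz
  · intro z
    have := measurable_rootFactor z
    fun_prop
  · intro z
    have := measurable_rootFactor z
    fun_prop
  · intro z hz
    refine ⟨(√(min 1 (1 + z.re / 2)) ^ 3)⁻¹, fun r h0 h1 => ?_⟩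
    rw [one_div]
    exact norm_inv_rootFactor_pow_le hz le_rfl h0 h1 3
  · intro c hc
    refine ⟨3 / 2 * (1 / 2) * (√(min 1 (1 + c / 2)) ^ 5)⁻¹, fun z hz r h0 h1 => ?_⟩
    rw [div_eq_mul_inv, norm_mul, norm_mul, Complex.norm_real, Real.norm_of_nonneg h0.le]
    have h3 : ‖(-(3 / 2) : ℂ)‖ = 3 / 2 := by rw [norm_neg]; norm_num
    rw [h3]
    gcongr
    exact norm_inv_rootFactor_pow_le hc hz h0 h1 5

/-- `x ↦ ∫ W · 2 (1 - (1 + x ρ)^{-1/2}) / ρ`, in a form without cancellation. -/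
def angleIntegral (W ρ : ℝ → ℝ) (x : ℝ) : ℝ :=
  ∫ ζ in Ioi (0 : ℝ), W ζ * (2 * x / (√(1 + x * ρ ζ) * (1 + √(1 + x * ρ ζ))))

/-- The derivative of `angleIntegral`. -/
def angleIntegralDeriv (W ρ : ℝ → ℝ) (x : ℝ) : ℝ :=
  ∫ ζ in Ioi (0 : ℝ), W ζ * (1 / √(1 + x * ρ ζ) ^ 3)

theorem one_add_mul_pos {x r : ℝ} (hx : -2 < x) (h0 : 0 < r) (h1 : r ≤ 1 / 2) :
    0 < 1 + x * r := by
  rcases le_total 0 x with h | h <;> nlinarith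

theorem angleIntegral_eq (hρ : ∀ ζ, 0 < ζ → 0 < ρ ζ ∧ ρ ζ ≤ 1 / 2) {x : ℝ} (hx : -2 < x) :
    ((angleIntegral W ρ x : ℝ) : ℂ) = ∫ ζ in Ioi (0 : ℝ),
      (W ζ : ℂ) * (2 * x / (rootFactor x (ρ ζ) * (1 + rootFactor x (ρ ζ)))) := by
  rw [angleIntegral, ← integral_complex_ofReal]
  refine setIntegral_congr_fun measurableSet_Ioi fun ζ hζ => ?_
  rw [rootFactor_ofReal (one_add_mul_pos hx (hρ ζ hζ).1 (hρ ζ hζ).2).le]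
  push_cast
  ring

theorem angleIntegralDeriv_eq (hρ : ∀ ζ, 0 < ζ → 0 < ρ ζ ∧ ρ ζ ≤ 1 / 2) {x : ℝ} (hx : -2 < x) :
    ((angleIntegralDeriv W ρ x : ℝ) : ℂ) = ∫ ζ in Ioi (0 : ℝ),
      (W ζ : ℂ) * (1 / rootFactor x (ρ ζ) ^ 3) := by
  rw [angleIntegralDeriv, ← integral_complex_ofReal]
  refine setIntegral_congr_fun measurableSet_Ioi fun ζ hζ => ?_
  rw [rootFactor_ofReal (one_add_mul_pos hx (hρ ζ hζ).1 (hρ ζ hζ).2).le]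
  push_cast
  ring

theorem hasDerivAt_angleIntegral (hW : IntegrableOn W (Ioi 0)) (hρm : Measurable ρ)
    (hρ : ∀ ζ, 0 < ζ → 0 < ρ ζ ∧ ρ ζ ≤ 1 / 2) {x : ℝ} (hx : -2 < x) :
    HasDerivAt (angleIntegral W ρ) (angleIntegralDeriv W ρ x) x := by
  have h := (hasDerivAt_complex_integral hW hρm hρ (z := x) (by simpa using hx)).real_of_complex
  rw [← angleIntegralDeriv_eq hρ hx, Complex.ofReal_re] at h
  refine h.congr_of_eventuallyEq ?_
  filter_upwards [lt_mem_nhds hx] with y hy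
  rw [← angleIntegral_eq hρ hy, Complex.ofReal_re]

theorem hasDerivAt_angleIntegralDeriv (hW : IntegrableOn W (Ioi 0)) (hρm : Measurable ρ)
    (hρ : ∀ ζ, 0 < ζ → 0 < ρ ζ ∧ ρ ζ ≤ 1 / 2) {x : ℝ} (hx : -2 < x) :
    HasDerivAt (angleIntegralDeriv W ρ)
      (∫ ζ in Ioi (0 : ℝ), W ζ * (-(3 / 2) * ρ ζ / √(1 + x * ρ ζ) ^ 5)) x := by
  have h := (hasDerivAt_complex_integral_deriv hW hρm hρ
    (z := x) (by simpa using hx)).real_of_complex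
  have h2 : (∫ ζ in Ioi (0 : ℝ), (W ζ : ℂ) * (-(3 / 2) * ρ ζ / rootFactor x (ρ ζ) ^ 5)) =
      ((∫ ζ in Ioi (0 : ℝ), W ζ * (-(3 / 2) * ρ ζ / √(1 + x * ρ ζ) ^ 5) : ℝ) : ℂ) := by
    rw [← integral_complex_ofReal]
    refine setIntegral_congr_fun measurableSet_Ioi fun ζ hζ => ?_
    rw [rootFactor_ofReal (one_add_mul_pos hx (hρ ζ hζ).1 (hρ ζ hζ).2).le]
    push_cast
    ring
  rw [h2, Complex.ofReal_re] at h
  refine h.congr_of_eventuallyEq ?_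
  filter_upwards [lt_mem_nhds hx] with y hy
  rw [← angleIntegralDeriv_eq hρ hy, Complex.ofReal_re]

theorem analyticAt_angleIntegral (hW : IntegrableOn W (Ioi 0)) (hρm : Measurable ρ)
    (hρ : ∀ ζ, 0 < ζ → 0 < ρ ζ ∧ ρ ζ ≤ 1 / 2) {x : ℝ} (hx : -2 < x) :
    AnalyticAt ℝ (angleIntegral W ρ) x := by
  have hopen : IsOpen {z : ℂ | -2 < z.re} := isOpen_lt continuous_const Complex.continuous_re
  have hd : DifferentiableOn ℂ (fun z : ℂ => ∫ ζ in Ioi (0 : ℝ),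
        (W ζ : ℂ) * (2 * z / (rootFactor z (ρ ζ) * (1 + rootFactor z (ρ ζ)))))
      {z : ℂ | -2 < z.re} := fun z hz =>
    (hasDerivAt_complex_integral hW hρm hρ hz).differentiableAt.differentiableWithinAt
  have ha := (hd.analyticAt (hopen.mem_nhds (show -2 < ((x : ℝ) : ℂ).re by simpa using hx)))
  have hr := ha.re_ofReal
  refine hr.congr ?_
  filter_upwards [lt_mem_nhds hx] with y hy
  rw [← angleIntegral_eq hρ hy, Complex.ofReal_re]

theorem angleIntegralDeriv_pos (hW : IntegrableOn W (Ioi 0)) (hρm : Measurable ρ)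
    (hρ : ∀ ζ, 0 < ζ → 0 < ρ ζ ∧ ρ ζ ≤ 1 / 2) (hWp : ∀ ζ, 0 < ζ → 0 < W ζ) {x : ℝ} (hx : 0 ≤ x) :
    0 < angleIntegralDeriv W ρ x := by
  have hpos : ∀ ζ ∈ Ioi (0 : ℝ), 0 < W ζ * (1 / √(1 + x * ρ ζ) ^ 3) := by
    intro ζ hζ
    have := hWp ζ hζ
    have h2 := one_add_mul_pos (by linarith : -2 < x) (hρ ζ hζ).1 (hρ ζ hζ).2
    positivity
  rw [angleIntegralDeriv, setIntegral_pos_iff_support_of_nonneg_ae]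
  · rw [inter_eq_self_of_subset_right]
    · simp
    · exact fun ζ hζ => (hpos ζ hζ).ne'
  · filter_upwards [ae_restrict_mem measurableSet_Ioi] with ζ hζ using (hpos ζ hζ).le
  · refine Integrable.mono' hW ?_ ?_
    · refine hW.aestronglyMeasurable.mul (Measurable.aestronglyMeasurable ?_)
      fun_prop
    · filter_upwards [ae_restrict_mem measurableSet_Ioi] with ζ hζ
      rw [Real.norm_of_nonneg (hpos ζ hζ).le]
      refine mul_le_of_le_one_right (hWp ζ hζ).le ?_
      rw [div_le_one₀ (by have := one_add_mul_pos (by linarith : -2 < x) (hρ ζ hζ).1 (hρ ζ hζ).2; positivity)]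
      refine one_le_pow₀ (Real.one_le_sqrt.2 ?_)
      nlinarith [(hρ ζ hζ).1]

theorem angleIntegral_zero : angleIntegral W ρ 0 = 0 := by simp [angleIntegral]

theorem strictMonoOn_angleIntegral (hW : IntegrableOn W (Ioi 0)) (hρm : Measurable ρ)
    (hρ : ∀ ζ, 0 < ζ → 0 < ρ ζ ∧ ρ ζ ≤ 1 / 2) (hWp : ∀ ζ, 0 < ζ → 0 < W ζ) :
    StrictMonoOn (angleIntegral W ρ) (Ici 0) := by
  refine strictMonoOn_of_deriv_pos (convex_Ici 0) ?_ ?_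
  · intro x hx
    exact (hasDerivAt_angleIntegral hW hρm hρ
      (by have := mem_Ici.1 hx; linarith)).continuousAt.continuousWithinAt
  · intro x hx
    rw [interior_Ici] at hx
    have hx := mem_Ioi.1 hx
    rw [(hasDerivAt_angleIntegral hW hρm hρ (by linarith)).deriv]
    exact angleIntegralDeriv_pos hW hρm hρ hWp hx.le

end Weighted

/-! ### The limiting integral ψ_∞ as an angle integral -/

/-- An integrable majorant on `(0, ∞)`. -/
def majorant (ζ : ℝ) : ℝ := min 1 (2 * ζ) / (2 * ζ * √(2 * ζ))

theorem majorant_nonneg {ζ : ℝ} (hζ : 0 < ζ) : 0 ≤ majorant ζ := by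
  unfold majorant
  positivity

theorem rpow_neg_three_half {ζ : ℝ} (hζ : 0 < ζ) : ζ ^ (-(3 / 2) : ℝ) = 1 / (ζ * √ζ) := by
  rw [Real.rpow_neg hζ.le, one_div, Real.sqrt_eq_rpow]
  congr 1
  nth_rewrite 2 [← Real.rpow_one ζ]
  rw [← Real.rpow_add hζ]
  norm_num

theorem rpow_neg_half {ζ : ℝ} (hζ : 0 < ζ) : ζ ^ (-(1 / 2) : ℝ) = 1 / √ζ := by
  rw [Real.rpow_neg hζ.le, Real.sqrt_eq_rpow, one_div (ζ ^ _)]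

theorem integrableOn_majorant : IntegrableOn majorant (Ioi 0) := by
  have hm : Measurable majorant := by unfold majorant; fun_prop
  rw [← Ioc_union_Ioi_eq_Ioi (zero_le_one' ℝ)]
  refine IntegrableOn.union ?_ ?_
  · have h := (intervalIntegral.intervalIntegrable_rpow' (a := 0) (b := 1)
      (r := -(1 / 2)) (by norm_num)).1
    refine Integrable.mono' h hm.aestronglyMeasurable ?_
    filter_upwards [ae_restrict_mem measurableSet_Ioc] with ζ hζ
    have h0 := hζ.1
    rw [Real.norm_of_nonneg (majorant_nonneg h0), rpow_neg_half h0, majorant]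
    calc _ ≤ (2 * ζ) / (2 * ζ * √(2 * ζ)) := by gcongr; exact min_le_right _ _
      _ = 1 / √(2 * ζ) := by field_simp
      _ ≤ 1 / √ζ := by gcongr; linarith
  · have h := integrableOn_Ioi_rpow_of_lt (a := -(3 / 2)) (by norm_num) one_pos
    refine Integrable.mono' h hm.aestronglyMeasurable ?_
    filter_upwards [ae_restrict_mem measurableSet_Ioi] with ζ hζ
    have h0 : 0 < ζ := one_pos.trans hζ
    rw [Real.norm_of_nonneg (majorant_nonneg h0), rpow_neg_three_half h0, majorant]
    calc _ ≤ 1 / (2 * ζ * √(2 * ζ)) := by gcongr; exact min_le_left _ _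
      _ ≤ 1 / (ζ * √ζ) := by gcongr <;> linarith

theorem one_sub_exp_neg_pos {x : ℝ} (hx : 0 < x) : 0 < 1 - Real.exp (-x) := by
  simpa using hx

theorem one_sub_exp_neg_le (x : ℝ) : 1 - Real.exp (-x) ≤ x := by
  linarith [Real.one_sub_le_exp_neg x]

theorem one_sub_exp_neg_le_one (x : ℝ) : 1 - Real.exp (-x) ≤ 1 := by
  linarith [Real.exp_pos (-x)]

theorem one_sub_exp_neg_le_min {ζ : ℝ} (hζ : 0 < ζ) :
    1 - Real.exp (-ζ) ≤ min 1 (2 * ζ) :=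
  le_min (one_sub_exp_neg_le_one _) ((one_sub_exp_neg_le _).trans (by linarith))

/-- The weight `(1 - e^{-ζ}) / (2ζ)^{3/2}` of `ψ_∞`. -/
def limWeight (ζ : ℝ) : ℝ := (1 - Real.exp (-ζ)) / (2 * ζ * √(2 * ζ))

/-- The ratio `(1 - e^{-ζ}) / (2ζ)`. -/
def limRatio (ζ : ℝ) : ℝ := (1 - Real.exp (-ζ)) / (2 * ζ)

theorem measurable_limWeight : Measurable limWeight := by unfold limWeight; fun_prop

theorem measurable_limRatio : Measurable limRatio := by unfold limRatio; fun_prop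

theorem limWeight_pos {ζ : ℝ} (hζ : 0 < ζ) : 0 < limWeight ζ := by
  have := one_sub_exp_neg_pos hζ
  unfold limWeight
  positivity

theorem limRatio_mem (ζ : ℝ) (hζ : 0 < ζ) : 0 < limRatio ζ ∧ limRatio ζ ≤ 1 / 2 := by
  have := one_sub_exp_neg_pos hζ
  unfold limRatio
  refine ⟨by positivity, ?_⟩
  rw [div_le_iff₀ (by positivity)]
  linarith [one_sub_exp_neg_le ζ]

theorem limWeight_le_majorant {ζ : ℝ} (hζ : 0 < ζ) : limWeight ζ ≤ majorant ζ := by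
  unfold limWeight majorant
  gcongr
  exact one_sub_exp_neg_le_min hζ

theorem integrableOn_limWeight : IntegrableOn limWeight (Ioi 0) := by
  refine Integrable.mono' integrableOn_majorant measurable_limWeight.aestronglyMeasurable ?_
  filter_upwards [ae_restrict_mem measurableSet_Ioi] with ζ hζ
  rw [Real.norm_of_nonneg (limWeight_pos hζ).le]
  exact limWeight_le_majorant hζ

theorem hFun_eq {ζ : ℝ} (hζ : 0 < ζ) (x : ℝ) : hFun ζ x = 2 * ζ * (1 + x * limRatio ζ) := by
  unfold hFun limRatio
  field_simp

theorem psiInf_eq (x : ℝ) : psiInf x = angleIntegral limWeight limRatio x := by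
  rw [psiInf, angleIntegral, ← integral_const_mul]
  refine setIntegral_congr_fun measurableSet_Ioi fun ζ hζ => ?_
  have h0 : 0 < ζ := hζ
  have hq : 0 < √(2 * ζ) := by positivity
  have hs : √(2 * ζ) ^ 2 = 2 * ζ := Real.sq_sqrt (by positivity)
  have hW : limWeight ζ = (1 - Real.exp (-ζ)) / (√(2 * ζ) ^ 2 * √(2 * ζ)) := by
    rw [hs, limWeight]
  rw [hFun_eq h0, Real.sqrt_mul (by positivity : 0 ≤ 2 * ζ), hW]
  have ht : 0 ≤ √(1 + x * limRatio ζ) := Real.sqrt_nonneg _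
  generalize √(1 + x * limRatio ζ) = t at *
  generalize √(2 * ζ) = q at *
  rw [← mul_one_add q t]
  -- At t = 0 both quotients are zero by the convention for division by zero, so the identity needs
  -- no condition on x.
  rcases ht.eq_or_lt with rfl | ht
  · simp
  field_simp

/-- The derivative of `ψ_∞`. -/
def psiDeriv : ℝ → ℝ := angleIntegralDeriv limWeight limRatio

theorem psiInf_eq_angleIntegral : psiInf = angleIntegral limWeight limRatio := funext psiInf_eq

theorem hasDerivAt_psiInf {x : ℝ} (hx : -2 < x) : HasDerivAt psiInf (psiDeriv x) x := by
  rw [psiInf_eq_angleIntegral]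
  exact hasDerivAt_angleIntegral integrableOn_limWeight measurable_limRatio limRatio_mem hx

theorem analyticAt_psiInf {x : ℝ} (hx : -2 < x) : AnalyticAt ℝ psiInf x := by
  rw [psiInf_eq_angleIntegral]
  exact analyticAt_angleIntegral integrableOn_limWeight measurable_limRatio limRatio_mem hx

theorem psiDeriv_pos {x : ℝ} (hx : 0 ≤ x) : 0 < psiDeriv x :=
  angleIntegralDeriv_pos integrableOn_limWeight measurable_limRatio limRatio_mem
    (fun _ => limWeight_pos) hx

theorem strictMonoOn_psiInf : StrictMonoOn psiInf (Ici 0) := by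
  rw [psiInf_eq_angleIntegral]
  exact strictMonoOn_angleIntegral integrableOn_limWeight measurable_limRatio limRatio_mem
    (fun _ => limWeight_pos)

theorem psiInf_zero : psiInf 0 = 0 := by simp [psiInf]

theorem psiInf_pos {x : ℝ} (hx : 0 < x) : 0 < psiInf x := by
  rw [← psiInf_zero]
  exact strictMonoOn_psiInf self_mem_Ici hx.le hx

/-! ### Exact first and second derivatives of ψ_∞ at zero -/

theorem rpow_neg_three_half_eq_mul {ζ : ℝ} (hζ : 0 < ζ) :
    ζ ^ (-(3 / 2) : ℝ) = 2 * √2 * (1 / (2 * ζ * √(2 * ζ))) := by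
  rw [rpow_neg_three_half hζ, Real.sqrt_mul (by norm_num)]
  field_simp

theorem integrableOn_one_sub_exp_mul_rpow {c : ℝ} (hc : 0 < c) (hc2 : c ≤ 2) :
    IntegrableOn (fun ζ : ℝ => (1 - Real.exp (-(c * ζ))) * ζ ^ (-(3 / 2) : ℝ)) (Ioi 0) := by
  refine Integrable.mono' (integrableOn_majorant.const_mul (2 * √2))
    (Measurable.aestronglyMeasurable (by fun_prop)) ?_
  filter_upwards [ae_restrict_mem measurableSet_Ioi] with ζ hζ
  have h0 : 0 < ζ := hζ
  have := one_sub_exp_neg_pos (mul_pos hc h0)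
  rw [Real.norm_of_nonneg (by positivity), rpow_neg_three_half_eq_mul h0, majorant]
  calc _ = 2 * √2 * ((1 - Real.exp (-(c * ζ))) / (2 * ζ * √(2 * ζ))) := by ring
    _ ≤ _ := by
      gcongr
      exact le_min (one_sub_exp_neg_le_one _) ((one_sub_exp_neg_le _).trans (by gcongr))

theorem integrableOn_exp_mul_rpow {c : ℝ} (hc : 0 < c) :
    IntegrableOn (fun ζ : ℝ => ζ ^ (-(1 / 2) : ℝ) * Real.exp (-(c * ζ))) (Ioi 0) := by
  have := integrableOn_rpow_mul_exp_neg_mul_rpow (p := 1) (s := -(1 / 2)) (b := c)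
    (by norm_num) one_pos hc
  simpa using this

theorem integral_exp_mul_rpow {c : ℝ} (hc : 0 < c) :
    ∫ ζ in Ioi (0 : ℝ), ζ ^ (-(1 / 2) : ℝ) * Real.exp (-(c * ζ)) = √Real.pi / √c := by
  have := Real.integral_rpow_mul_exp_neg_mul_Ioi (a := 1 / 2) (by norm_num) hc
  norm_num at this
  norm_num
  rw [this, Real.inv_rpow hc.le, Real.sqrt_eq_rpow c]
  norm_num [Real.Gamma_one_half_eq]
  ring

/-- Kills the boundary term at 0 in the integrations by parts below; a surplus of half a power is
what occurs in both. -/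
theorem tendsto_mul_rpow_zero {u : ℝ → ℝ} {C e k : ℝ} (hk : k = e + 1 / 2)
    (h0 : ∀ ζ, 0 < ζ → 0 ≤ u ζ) (h1 : ∀ ζ, 0 < ζ → u ζ ≤ C * ζ ^ k) :
    Tendsto (fun ζ => u ζ * ζ ^ (-e : ℝ)) (𝓝[>] 0) (𝓝 0) := by
  have hlim : Tendsto (fun ζ : ℝ => C * ζ ^ (1 / 2 : ℝ)) (𝓝[>] 0) (𝓝 0) := by
    have : ContinuousAt (fun ζ : ℝ => C * ζ ^ (1 / 2 : ℝ)) 0 :=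
      (Real.continuousAt_rpow_const 0 (1 / 2) (Or.inr (by norm_num))).const_mul C
    have := this.tendsto
    rw [Real.zero_rpow (by norm_num), mul_zero] at this
    exact this.mono_left nhdsWithin_le_nhds
  refine tendsto_of_tendsto_of_tendsto_of_le_of_le' tendsto_const_nhds hlim ?_ ?_
  · filter_upwards [self_mem_nhdsWithin] with ζ hζ
    exact mul_nonneg (h0 ζ hζ) (Real.rpow_nonneg (le_of_lt hζ) _)
  · filter_upwards [self_mem_nhdsWithin] with ζ hζ
    have hζ0 : 0 < ζ := hζ
    calc _ ≤ C * ζ ^ k * ζ ^ (-e) := by gcongr; exact h1 ζ hζ0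
      _ = _ := by rw [mul_assoc, ← Real.rpow_add hζ0, hk]; ring_nf

theorem tendsto_mul_rpow_atTop {u : ℝ → ℝ} {e : ℝ} (he : 0 < e)
    (h0 : ∀ ζ, 0 < ζ → 0 ≤ u ζ) (h1 : ∀ ζ, 0 < ζ → u ζ ≤ 1) :
    Tendsto (fun ζ => u ζ * ζ ^ (-e : ℝ)) atTop (𝓝 0) := by
  refine tendsto_of_tendsto_of_tendsto_of_le_of_le' tendsto_const_nhds
    (tendsto_rpow_neg_atTop he) ?_ ?_
  · filter_upwards [eventually_gt_atTop 0] with ζ hζ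
    exact mul_nonneg (h0 ζ hζ) (Real.rpow_nonneg (le_of_lt hζ) _)
  · filter_upwards [eventually_gt_atTop 0] with ζ hζ
    exact mul_le_of_le_one_left (by positivity) (h1 ζ hζ)

theorem hasDerivAt_one_sub_exp (c x : ℝ) :
    HasDerivAt (fun ζ : ℝ => 1 - Real.exp (-(c * ζ))) (c * Real.exp (-(c * x))) x := by
  have := ((((hasDerivAt_id x).const_mul c).neg).exp).const_sub 1
  refine this.congr_deriv ?_
  simp
  ring

/-- Integration by parts against -2ζ^(-1/2) reduces this to Γ(1/2). The restriction c ≤ 2 only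
serves the domination by `majorant`; the values needed are c = 1 and c = 2. -/
theorem integral_one_sub_exp_mul_rpow {c : ℝ} (hc : 0 < c) (hc2 : c ≤ 2) :
    ∫ ζ in Ioi (0 : ℝ), (1 - Real.exp (-(c * ζ))) * ζ ^ (-(3 / 2) : ℝ)
      = 2 * √c * √Real.pi := by
  have hint := integrableOn_one_sub_exp_mul_rpow hc hc2
  have hint2 : IntegrableOn
      (fun ζ : ℝ => c * Real.exp (-(c * ζ)) * (-2 * ζ ^ (-(1 / 2) : ℝ))) (Ioi 0) := by
    refine ((integrableOn_exp_mul_rpow hc).const_mul (-2 * c)).congr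
      (Eventually.of_forall fun ζ => ?_)
    ring
  have hpos : ∀ ζ, 0 < ζ → 0 ≤ 1 - Real.exp (-(c * ζ)) :=
    fun ζ hζ => (one_sub_exp_neg_pos (mul_pos hc hζ)).le
  have key := integral_Ioi_deriv_mul_eq_sub (a := (0 : ℝ)) (a' := (-2) * 0) (b' := (-2) * 0)
    (u := fun ζ : ℝ => 1 - Real.exp (-(c * ζ)))
    (u' := fun ζ => c * Real.exp (-(c * ζ))) (v := fun ζ => -2 * ζ ^ (-(1 / 2) : ℝ))
    (v' := fun ζ => ζ ^ (-(3 / 2) : ℝ)) (fun x _ => hasDerivAt_one_sub_exp c x)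
    (fun x hx => by
      have := (Real.hasDerivAt_rpow_const (x := x) (p := -(1 / 2))
        (Or.inl (ne_of_gt hx))).const_mul (-2)
      refine this.congr_deriv ?_
      norm_num
      ring)
    (hint2.add hint)
    (by
      have := (tendsto_mul_rpow_zero (u := fun ζ => 1 - Real.exp (-(c * ζ))) (C := c)
        (e := 1 / 2) (k := 1) (by norm_num) hpos
        (fun ζ _ => by simpa using one_sub_exp_neg_le (c * ζ))).const_mul (-2)
      refine this.congr fun ζ => ?_
      simp only [Pi.mul_apply]
      ring)
    (by
      have := (tendsto_mul_rpow_atTop (u := fun ζ => 1 - Real.exp (-(c * ζ)))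
        (e := 1 / 2) (by norm_num) hpos
        (fun ζ _ => one_sub_exp_neg_le_one (c * ζ))).const_mul (-2)
      refine this.congr fun ζ => ?_
      simp only [Pi.mul_apply]
      ring)
  rw [integral_add hint2 hint] at key
  have h3 : ∫ ζ in Ioi (0 : ℝ), c * Real.exp (-(c * ζ)) * (-2 * ζ ^ (-(1 / 2) : ℝ))
      = -2 * c * (√Real.pi / √c) := by
    rw [← integral_exp_mul_rpow hc, ← integral_const_mul]
    congr 1 with ζ
    ring
  rw [h3] at key
  have h4 : c = √c * √c := (Real.mul_self_sqrt hc.le).symm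
  have h5 : 0 < √c := by positivity
  have h6 : c * (√Real.pi / √c) = √c * √Real.pi := by
    nth_rewrite 1 [h4]
    field_simp
  linarith

theorem integral_one_sub_exp_sq_mul_rpow :
    ∫ ζ in Ioi (0 : ℝ), (1 - Real.exp (-ζ)) ^ 2 * ζ ^ (-(5 / 2) : ℝ)
      = 8 / 3 * √Real.pi * (√2 - 1) := by
  have hpos : ∀ ζ, 0 < ζ → 0 ≤ (1 - Real.exp (-ζ)) := fun ζ hζ => (one_sub_exp_neg_pos hζ).le
  have h1 := integrableOn_one_sub_exp_mul_rpow one_pos one_le_two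
  have h2 := integrableOn_one_sub_exp_mul_rpow two_pos le_rfl
  simp only [one_mul] at h1
  have hexp : ∀ ζ : ℝ, Real.exp (-(2 * ζ)) = Real.exp (-ζ) ^ 2 := fun ζ => by
    rw [← Real.exp_nat_mul]; push_cast; ring_nf
  -- After integration by parts, e^{-ζ} - e^{-2ζ} is split as (1 - e^{-2ζ}) - (1 - e^{-ζ}), so that
  -- the previous integral applies with c = 2 and c = 1.
  have heq : ∀ ζ : ℝ, 2 * (1 - Real.exp (-ζ)) * Real.exp (-ζ) * (-(2 / 3) * ζ ^ (-(3 / 2) : ℝ)) =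
      -(4 / 3) * ((1 - Real.exp (-(2 * ζ))) * ζ ^ (-(3 / 2) : ℝ)
        - (1 - Real.exp (-ζ)) * ζ ^ (-(3 / 2) : ℝ)) := fun ζ => by
    rw [hexp]; ring
  have hint : IntegrableOn (fun ζ : ℝ => (1 - Real.exp (-ζ)) ^ 2 * ζ ^ (-(5 / 2) : ℝ)) (Ioi 0) := by
    refine Integrable.mono' h1 (Measurable.aestronglyMeasurable (by fun_prop)) ?_
    filter_upwards [ae_restrict_mem measurableSet_Ioi] with ζ hζ
    have h0 : 0 < ζ := hζ
    have := hpos ζ hζ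
    rw [Real.norm_of_nonneg (by positivity)]
    calc _ ≤ (1 - Real.exp (-ζ)) * ζ * ζ ^ (-(5 / 2) : ℝ) := by
          rw [sq]; gcongr; exact one_sub_exp_neg_le ζ
      _ = (1 - Real.exp (-ζ)) * (ζ ^ (1 : ℝ) * ζ ^ (-(5 / 2) : ℝ)) := by
          rw [Real.rpow_one]; ring
      _ = _ := by rw [← Real.rpow_add h0]; norm_num
  have hint2 : IntegrableOn (fun ζ : ℝ =>
      2 * (1 - Real.exp (-ζ)) * Real.exp (-ζ) * (-(2 / 3) * ζ ^ (-(3 / 2) : ℝ))) (Ioi 0) := by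
    simp only [heq]
    exact (h2.sub h1).const_mul _
  have key := integral_Ioi_deriv_mul_eq_sub (a := (0 : ℝ)) (a' := (-(2 / 3)) * 0)
    (b' := (-(2 / 3)) * 0) (u := fun ζ : ℝ => (1 - Real.exp (-ζ)) ^ 2)
    (u' := fun ζ => 2 * (1 - Real.exp (-ζ)) * Real.exp (-ζ))
    (v := fun ζ => -(2 / 3) * ζ ^ (-(3 / 2) : ℝ))
    (v' := fun ζ => ζ ^ (-(5 / 2) : ℝ)) (fun x _ => by
      have := (hasDerivAt_one_sub_exp 1 x).pow 2
      simp only [one_mul] at this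
      refine this.congr_deriv ?_
      norm_num)
    (fun x hx => by
      have := (Real.hasDerivAt_rpow_const (x := x) (p := -(3 / 2))
        (Or.inl (ne_of_gt hx))).const_mul (-(2 / 3))
      refine this.congr_deriv ?_
      norm_num
      ring)
    (hint2.add hint)
    (by
      have := (tendsto_mul_rpow_zero (u := fun ζ => (1 - Real.exp (-ζ)) ^ 2) (C := 1)
        (e := 3 / 2) (k := 2) (by norm_num) (fun ζ _ => sq_nonneg _)
        (fun ζ hζ => by
          rw [one_mul, Real.rpow_two]
          exact pow_le_pow_left₀ (hpos ζ hζ) (one_sub_exp_neg_le ζ) 2)).const_mul (-(2 / 3))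
      refine this.congr fun ζ => ?_
      simp only [Pi.mul_apply]
      ring)
    (by
      have := (tendsto_mul_rpow_atTop (u := fun ζ => (1 - Real.exp (-ζ)) ^ 2)
        (e := 3 / 2) (by norm_num) (fun ζ _ => sq_nonneg _)
        (fun ζ hζ => pow_le_one₀ (hpos ζ hζ) (one_sub_exp_neg_le_one ζ))).const_mul (-(2 / 3))
      refine this.congr fun ζ => ?_
      simp only [Pi.mul_apply]
      ring)
  rw [integral_add hint2 hint] at key
  have e1 := integral_one_sub_exp_mul_rpow one_pos one_le_two
  have e2 := integral_one_sub_exp_mul_rpow two_pos le_rfl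
  simp only [one_mul, Real.sqrt_one, mul_one] at e1
  simp only [heq] at key
  rw [integral_const_mul, integral_sub h2 h1, e1, e2] at key
  linarith

theorem psiDeriv_zero : psiDeriv 0 = √Real.pi / √2 := by
  have h := integral_one_sub_exp_mul_rpow one_pos one_le_two
  simp only [one_mul, Real.sqrt_one, mul_one] at h
  have h2 : (∫ ζ in Ioi (0 : ℝ), (1 - Real.exp (-ζ)) * ζ ^ (-(3 / 2) : ℝ))
      = 2 * √2 * psiDeriv 0 := by
    rw [psiDeriv, angleIntegralDeriv, ← integral_const_mul]
    refine setIntegral_congr_fun measurableSet_Ioi fun ζ hζ => ?_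
    rw [rpow_neg_three_half_eq_mul hζ, limWeight]
    simp
    ring
  rw [h] at h2
  field_simp
  linarith

theorem hasDerivAt_psiDeriv_zero :
    HasDerivAt psiDeriv (-(√Real.pi * (1 - 1 / √2))) 0 := by
  have h := hasDerivAt_angleIntegralDeriv integrableOn_limWeight measurable_limRatio limRatio_mem
    (x := 0) (by norm_num)
  refine h.congr_deriv ?_
  have h2 : (∫ ζ in Ioi (0 : ℝ), limWeight ζ * (-(3 / 2) * limRatio ζ / √(1 + 0 * limRatio ζ) ^ 5))
      = -(3 / 2) / (4 * √2) *
        ∫ ζ in Ioi (0 : ℝ), (1 - Real.exp (-ζ)) ^ 2 * ζ ^ (-(5 / 2) : ℝ) := by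
    rw [← integral_const_mul]
    refine setIntegral_congr_fun measurableSet_Ioi fun ζ hζ => ?_
    have h0 : 0 < ζ := hζ
    have h5 : ζ ^ (-(5 / 2) : ℝ) = 1 / (ζ ^ 2 * √ζ) := by
      have : (-(5 / 2) : ℝ) = -(3 / 2) + (-1) := by norm_num
      rw [this, Real.rpow_add h0, rpow_neg_three_half h0, Real.rpow_neg_one]
      field_simp
    rw [h5, limWeight, limRatio, Real.sqrt_mul (by norm_num)]
    simp
    field_simp
    norm_num
  rw [h2, integral_one_sub_exp_sq_mul_rpow]
  field_simp
  ring

/-! ### Behaviour of ψ_∞ and its derivative at infinity -/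

/-- The quotient r / s² is 2tr/(2t + r), which is at most both r ≤ 1 and 2t. Decay s⁻² thus
compensates the non-integrable t^(-3/2) at the origin, uniformly in r. -/
theorem weight_mul_inv_sq_le_majorant {t r s : ℝ} (ht : 0 < t) (hr0 : 0 ≤ r) (hr : r ≤ 1)
    (hs : s ^ 2 = 1 + r / (2 * t)) : r / (2 * t * √(2 * t)) * (1 / s ^ 2) ≤ majorant t := by
  have h1 : r / (2 * t * √(2 * t)) * (1 / s ^ 2) = (2 * t * r / (2 * t + r)) / (2 * t * √(2 * t)) := by
    rw [hs]
    field_simp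
  rw [h1, majorant]
  gcongr
  refine le_min ?_ ?_ <;> rw [div_le_iff₀ (by positivity)] <;> nlinarith

/-- Large `ξ` asymptotics of integrals against the weight of `ψ_∞`. -/
theorem tendsto_sqrt_mul_integral {φ : ℝ → ℝ} {C : ℝ} (hφm : Measurable φ)
    (hφc : ContinuousOn φ (Ioi 0)) (hφ : ∀ s, 1 ≤ s → |φ s| ≤ C * (1 / s ^ 2)) :
    Tendsto (fun x : ℝ => √x * ∫ ζ in Ioi (0 : ℝ), limWeight ζ * φ (√(1 + x * limRatio ζ))) atTop
      (𝓝 (∫ t in Ioi (0 : ℝ), 1 / (2 * t * √(2 * t)) * φ (√(1 + 1 / (2 * t))))) := by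
  have hC : 0 ≤ C := by
    have := (abs_nonneg _).trans (hφ 1 le_rfl)
    simpa using this
  have hlim : Tendsto (fun x : ℝ => ∫ t in Ioi (0 : ℝ), (1 - Real.exp (-(x * t))) /
      (2 * t * √(2 * t)) * φ (√(1 + (1 - Real.exp (-(x * t))) / (2 * t)))) atTop
      (𝓝 (∫ t in Ioi (0 : ℝ), 1 / (2 * t * √(2 * t)) * φ (√(1 + 1 / (2 * t))))) := by
    refine tendsto_integral_filter_of_dominated_convergence (fun t => C * majorant t) ?_ ?_
      (integrableOn_majorant.const_mul C) ?_
    · exact Eventually.of_forall fun x => Measurable.aestronglyMeasurable (by fun_prop)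
    · filter_upwards [eventually_gt_atTop 0] with x hx
      filter_upwards [ae_restrict_mem measurableSet_Ioi] with t ht
      have ht0 : 0 < t := ht
      have hr0 := one_sub_exp_neg_pos (mul_pos hx ht0)
      have hr1 := one_sub_exp_neg_le_one (x * t)
      set r := 1 - Real.exp (-(x * t))
      have hsq : √(1 + r / (2 * t)) ^ 2 = 1 + r / (2 * t) := Real.sq_sqrt (by positivity)
      have hs1 : 1 ≤ √(1 + r / (2 * t)) := by
        rw [Real.one_le_sqrt]
        have : 0 ≤ r / (2 * t) := by positivity
        linarith
      rw [norm_mul, Real.norm_of_nonneg (by positivity), Real.norm_eq_abs]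
      calc _ ≤ r / (2 * t * √(2 * t)) * (C * (1 / √(1 + r / (2 * t)) ^ 2)) := by
            gcongr; exact hφ _ hs1
        _ = C * (r / (2 * t * √(2 * t)) * (1 / √(1 + r / (2 * t)) ^ 2)) := by ring
        _ ≤ _ := by gcongr; exact weight_mul_inv_sq_le_majorant ht0 hr0.le hr1 hsq
    · filter_upwards [ae_restrict_mem measurableSet_Ioi] with t ht
      have ht0 : 0 < t := ht
      have hr : Tendsto (fun x : ℝ => 1 - Real.exp (-(x * t))) atTop (𝓝 1) := by
        have h : Tendsto (fun x : ℝ => Real.exp (-(x * t))) atTop (𝓝 0) :=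
          Real.tendsto_exp_neg_atTop_nhds_zero.comp (tendsto_id.atTop_mul_const ht0)
        simpa using h.const_sub 1
      refine (hr.div_const _).mul ?_
      have hs : Tendsto (fun x : ℝ => √(1 + (1 - Real.exp (-(x * t))) / (2 * t))) atTop
          (𝓝 (√(1 + 1 / (2 * t)))) :=
        (Real.continuous_sqrt.tendsto _).comp ((hr.div_const _).const_add 1)
      have hpos : 0 < √(1 + 1 / (2 * t)) := by positivity
      exact (hφc.continuousAt (Ioi_mem_nhds hpos)).tendsto.comp hs
  refine hlim.congr' ?_
  filter_upwards [eventually_gt_atTop 0] with x hx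
  -- The substitution ζ = xt: the weight contributes x^(-3/2) and the measure x, leaving the
  -- prefactor 1/√x.
  have h := integral_comp_mul_left_Ioi
    (fun ζ => limWeight ζ * φ (√(1 + x * limRatio ζ))) 0 hx
  rw [mul_zero, smul_eq_mul, inv_mul_eq_div, eq_div_iff hx.ne'] at h
  rw [← h, ← integral_mul_const, ← integral_const_mul]
  refine setIntegral_congr_fun measurableSet_Ioi fun t ht => ?_
  have ht0 : 0 < t := ht
  have h1 : x * limRatio (x * t) = (1 - Real.exp (-(x * t))) / (2 * t) := by
    unfold limRatio; field_simp
  have h2 : √(2 * (x * t)) = √x * √(2 * t) := by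
    rw [← Real.sqrt_mul hx.le]; ring_nf
  rw [h1, limWeight, h2]
  generalize φ _ = y
  have hq : 0 < √(2 * t) := by positivity
  have hx2 : 0 < √x := by positivity
  field_simp

theorem tendsto_sqrt_mul_psiDeriv : Tendsto (fun x => √x * psiDeriv x) atTop (𝓝 1) := by
  have h := tendsto_sqrt_mul_integral (φ := fun s => 1 / s ^ 3) (C := 1) (by fun_prop)
    (fun s hs => by
      have : s ≠ 0 := ne_of_gt hs
      fun_prop (disch := positivity))
    (fun s hs => by
      rw [abs_of_nonneg (by positivity), one_mul]
      exact one_div_le_one_div_of_le (by positivity) (pow_le_pow_right₀ hs (by norm_num)))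
  have hval : ∫ t in Ioi (0 : ℝ), 1 / (2 * t * √(2 * t)) * (1 / √(1 + 1 / (2 * t)) ^ 3) = 1 := by
    -- The limiting integrand simplifies to (2t + 1)^(-3/2).
    have key := integral_Ioi_of_hasDerivAt_of_nonneg' (a := 0) (l := 0)
      (g := fun t : ℝ => -(1 / √(2 * t + 1))) (g' := fun t => 1 / √(2 * t + 1) ^ 3) ?_ ?_ ?_
    · refine Eq.trans ?_ (key.trans (by norm_num))
      refine setIntegral_congr_fun measurableSet_Ioi fun t ht => ?_
      have ht0 : 0 < t := ht
      have h1 : √(1 + 1 / (2 * t)) = √(2 * t + 1) / √(2 * t) := by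
        rw [← Real.sqrt_div (by positivity)]
        congr 1
        field_simp
      have h2 : √(2 * t) ^ 2 = 2 * t := Real.sq_sqrt (by positivity)
      have hq : 0 < √(2 * t) := by positivity
      rw [h1]
      field_simp
      exact h2
    · intro t ht
      have ht0 : 0 ≤ t := ht
      have hp : 0 < 2 * t + 1 := by positivity
      have h1 := ((((((hasDerivAt_id t).const_mul 2).add_const 1).sqrt hp.ne').inv
        (by simp only [id]; positivity)).neg)
      simp only [one_div]
      refine h1.congr_deriv ?_
      simp only [id]
      have hq : 0 < √(2 * t + 1) := by positivity
      field_simp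
    · intro t ht
      positivity
    · have h1 : Tendsto (fun t : ℝ => √(2 * t + 1)) atTop atTop :=
        Real.tendsto_sqrt_atTop.comp
          (tendsto_atTop_add_const_right _ _ (tendsto_id.const_mul_atTop two_pos))
      simpa using h1.inv_tendsto_atTop.neg
  rw [hval] at h
  exact h

theorem tendsto_psiInf_div_sqrt : Tendsto (fun x => psiInf x / √x) atTop (𝓝 2) := by
  have h := tendsto_sqrt_mul_integral (φ := fun s => 2 / (s * (1 + s))) (C := 2) (by fun_prop)
    (fun s hs => by
      have h0 : 0 < s := hs
      have : s * (1 + s) ≠ 0 := by positivity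
      fun_prop (disch := positivity))
    (fun s hs => by
      rw [abs_of_nonneg (by positivity), mul_one_div]
      gcongr
      nlinarith)
  have hval : ∫ t in Ioi (0 : ℝ), 1 / (2 * t * √(2 * t)) *
      (2 / (√(1 + 1 / (2 * t)) * (1 + √(1 + 1 / (2 * t))))) = 2 := by
    have hsqrt : Tendsto (fun t : ℝ => √(2 * t)) atTop atTop :=
        Real.tendsto_sqrt_atTop.comp (tendsto_id.const_mul_atTop two_pos)
    have hs2 : ∀ t : ℝ, 0 < t → √(2 * t) ^ 2 = 2 * t := fun t ht => Real.sq_sqrt (by positivity)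
    have hs3 : ∀ t : ℝ, 0 < t → √(2 * t + 1) ^ 2 = 2 * t + 1 :=
      fun t ht => Real.sq_sqrt (by positivity)
    -- The limiting integrand simplifies to 2((2t)^(-1/2) - (2t + 1)^(-1/2)).
    have key := integral_Ioi_of_hasDerivAt_of_nonneg (a := 0) (l := 0)
      (g := fun t : ℝ => 2 * (√(2 * t) - √(2 * t + 1)))
      (g' := fun t => 2 * (1 / √(2 * t) - 1 / √(2 * t + 1))) ?_ ?_ ?_ ?_
    · refine Eq.trans ?_ (key.trans (by norm_num))
      refine setIntegral_congr_fun measurableSet_Ioi fun t ht => ?_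
      have ht0 : 0 < t := ht
      have h1 : √(1 + 1 / (2 * t)) = √(2 * t + 1) / √(2 * t) := by
        rw [← Real.sqrt_div (by positivity)]
        congr 1
        field_simp
      have h2 := hs2 t ht0
      have h3 := hs3 t ht0
      have hq : 0 < √(2 * t) := by positivity
      have hv : 0 < √(2 * t + 1) := by positivity
      rw [h1]
      nth_rewrite 1 [← h2]
      field_simp
      linear_combination h2 - h3
    · exact Continuous.continuousWithinAt (by fun_prop)
    · intro t ht
      have ht0 : 0 < t := ht
      have hp : 0 < 2 * t + 1 := by positivity
      have h1 := ((((hasDerivAt_id t).const_mul 2).sqrt (by simp only [id]; positivity)).sub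
        ((((hasDerivAt_id t).const_mul 2).add_const 1).sqrt hp.ne')).const_mul 2
      refine h1.congr_deriv ?_
      simp only [id]
      field_simp
    · intro t ht
      have ht0 : 0 < t := ht
      have : 1 / √(2 * t + 1) ≤ 1 / √(2 * t) := by gcongr; linarith
      linarith
    · have h1 : Tendsto (fun t : ℝ => -2 * (√(2 * t) + √(2 * t + 1))⁻¹) atTop (𝓝 (-2 * 0)) :=
        ((tendsto_atTop_mono (fun t => le_add_of_nonneg_right (Real.sqrt_nonneg _))
          hsqrt).inv_tendsto_atTop).const_mul _
      rw [mul_zero] at h1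
      refine h1.congr' ?_
      filter_upwards [eventually_gt_atTop 0] with t ht
      have hq : 0 < √(2 * t) := by positivity
      field_simp
      linear_combination hs3 t ht - hs2 t ht
  rw [hval] at h
  refine h.congr' ?_
  filter_upwards [eventually_gt_atTop 0] with x hx
  rw [psiInf_eq, angleIntegral, eq_div_iff (by positivity), mul_right_comm,
    Real.mul_self_sqrt hx.le, ← integral_const_mul]
  congr 1 with ζ
  ring

theorem tendsto_psiInf_atTop : Tendsto psiInf atTop atTop := by
  refine (tendsto_psiInf_div_sqrt.pos_mul_atTop two_pos Real.tendsto_sqrt_atTop).congr' ?_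
  filter_upwards [eventually_gt_atTop 0] with x hx
  have : 0 < √x := by positivity
  field_simp

/-! ### Bijectivity and the inverse function ξ_∞ -/

theorem bijOn_psiInf : BijOn psiInf (Ioi 0) (Ioi 0) := by
  refine ⟨fun x hx => psiInf_pos hx, (strictMonoOn_psiInf.mono Ioi_subset_Ici_self).injOn, ?_⟩
  intro y hy
  obtain ⟨N, hN⟩ := ((tendsto_psiInf_atTop.eventually_gt_atTop y).and
    (eventually_gt_atTop 0)).exists
  have hc : ContinuousOn psiInf (Icc 0 N) := fun x hx =>
    (hasDerivAt_psiInf (by linarith [hx.1])).continuousAt.continuousWithinAt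
  obtain ⟨x, hx, hxy⟩ := intermediate_value_Ioo hN.2.le hc
    (show y ∈ Ioo (psiInf 0) (psiInf N) from ⟨by rw [psiInf_zero]; exact hy, hN.1⟩)
  exact ⟨x, hx.1, hxy⟩

/-- `Function.invFunOn` is a mere choice, with no regularity of its own. Injectivity on (0, ∞)
identifies it near f x with the local inverse of the inverse function theorem, from which
differentiability and analyticity are inherited. -/
theorem invFunOn_eventuallyEq_localInverse {f : ℝ → ℝ} (hmono : StrictMonoOn f (Ioi 0)) {x f' : ℝ}
    (hx : 0 < x) (hf : HasStrictDerivAt f f' x) (hf' : f' ≠ 0) :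
    ∀ᶠ y in 𝓝 (f x), Function.invFunOn f (Ioi 0) y = hf.localInverse f f' x hf' y ∧
      0 < Function.invFunOn f (Ioi 0) y ∧ f (Function.invFunOn f (Ioi 0) y) = y := by
  have hc := (hf.to_localInverse hf').hasDerivAt.continuousAt
  have h1 : ∀ᶠ y in 𝓝 (f x), f (hf.localInverse f f' x hf' y) = y :=
    (hf.hasStrictFDerivAt_equiv hf').eventually_right_inverse
  have h2 : hf.localInverse f f' x hf' (f x) = x :=
    (hf.hasStrictFDerivAt_equiv hf').localInverse_apply_image
  have h3 : ∀ᶠ y in 𝓝 (f x), 0 < hf.localInverse f f' x hf' y :=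
    hc.eventually (lt_mem_nhds (by rw [h2]; exact hx))
  filter_upwards [h1, h3] with y hy hy0
  have hex : ∃ a ∈ Ioi (0 : ℝ), f a = y := ⟨_, hy0, hy⟩
  have h5 := Function.invFunOn_mem hex
  have h6 := Function.invFunOn_eq hex
  exact ⟨hmono.injOn h5 hy0 (h6.trans hy.symm), h5, h6⟩

theorem hasDerivAt_invFunOn {f : ℝ → ℝ} (hmono : StrictMonoOn f (Ioi 0)) {x f' : ℝ}
    (hx : 0 < x) (hf : HasStrictDerivAt f f' x) (hf' : f' ≠ 0) :
    HasDerivAt (Function.invFunOn f (Ioi 0)) f'⁻¹ (f x) :=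
  (hf.to_localInverse hf').hasDerivAt.congr_of_eventuallyEq
    ((invFunOn_eventuallyEq_localInverse hmono hx hf hf').mono fun _ h => h.1)

theorem invFunOn_apply_eq {f : ℝ → ℝ} (hmono : StrictMonoOn f (Ioi 0)) {x : ℝ} (hx : 0 < x) :
    Function.invFunOn f (Ioi 0) (f x) = x :=
  hmono.injOn.leftInvOn_invFunOn hx

theorem strictMonoOn_psiInf_Ioi : StrictMonoOn psiInf (Ioi 0) :=
  strictMonoOn_psiInf.mono Ioi_subset_Ici_self

theorem xiInf_psiInf {x : ℝ} (hx : 0 < x) : xiInf (psiInf x) = x :=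
  invFunOn_apply_eq strictMonoOn_psiInf_Ioi hx

theorem deriv_psiInf {x : ℝ} (hx : -2 < x) : deriv psiInf x = psiDeriv x :=
  (hasDerivAt_psiInf hx).deriv

theorem analyticAt_xiInf {x : ℝ} (hx : 0 < x) : AnalyticAt ℝ xiInf (psiInf x) := by
  have ha := analyticAt_psiInf (x := x) (by linarith)
  have hd : deriv psiInf x ≠ 0 := by
    rw [deriv_psiInf (by linarith)]; exact (psiDeriv_pos hx.le).ne'
  refine (ha.analyticAt_localInverse hd).congr ?_
  exact (invFunOn_eventuallyEq_localInverse strictMonoOn_psiInf_Ioi hx _ hd).mono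
    fun _ h => h.1.symm

theorem deriv_xiInf {x : ℝ} (hx : 0 < x) : deriv xiInf (psiInf x) = (psiDeriv x)⁻¹ := by
  have ha := analyticAt_psiInf (x := x) (by linarith)
  have hd := deriv_psiInf (x := x) (by linarith)
  rw [← hd]
  exact (hasDerivAt_invFunOn strictMonoOn_psiInf_Ioi hx ha.hasStrictDerivAt
    (by rw [hd]; exact (psiDeriv_pos hx.le).ne')).deriv

theorem exists_eq_psiInf {y : ℝ} (hy : 0 < y) : ∃ x, 0 < x ∧ psiInf x = y :=
  bijOn_psiInf.surjOn hy

theorem xiInf_pos {y : ℝ} (hy : 0 < y) : 0 < xiInf y := by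
  obtain ⟨x, hx, rfl⟩ := exists_eq_psiInf hy
  rwa [xiInf_psiInf hx]

theorem psiInf_xiInf {y : ℝ} (hy : 0 < y) : psiInf (xiInf y) = y := by
  obtain ⟨x, hx, rfl⟩ := exists_eq_psiInf hy
  rw [xiInf_psiInf hx]

theorem lt_xiInf_iff {x y : ℝ} (hx : 0 < x) (hy : 0 < y) : x < xiInf y ↔ psiInf x < y := by
  obtain ⟨z, hz, rfl⟩ := exists_eq_psiInf hy
  rw [xiInf_psiInf hz]
  exact (strictMonoOn_psiInf_Ioi.lt_iff_lt hx hz).symm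

theorem xiInf_lt_iff {x y : ℝ} (hx : 0 < x) (hy : 0 < y) : xiInf y < x ↔ y < psiInf x := by
  obtain ⟨z, hz, rfl⟩ := exists_eq_psiInf hy
  rw [xiInf_psiInf hz]
  exact (strictMonoOn_psiInf_Ioi.lt_iff_lt hz hx).symm

/-! ### The profile Φ: analyticity, limit at infinity, expansion at zero -/

theorem limitProfile_psiInf {x : ℝ} (hx : 0 < x) :
    limitProfile (psiInf x) = (1 / x + 1 / 2) / (psiInf x * psiDeriv x) := by
  have h1 := psiInf_pos hx
  have h2 := psiDeriv_pos hx.le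
  rw [limitProfile, xiInf_psiInf hx, deriv_xiInf hx]
  field_simp

theorem limitProfile_eq {y : ℝ} (hy : 0 < y) :
    limitProfile y = (1 / xiInf y + 1 / 2) / (y * psiDeriv (xiInf y)) := by
  have := limitProfile_psiInf (xiInf_pos hy)
  rwa [psiInf_xiInf hy] at this

theorem analyticOnNhd_limitProfile : AnalyticOnNhd ℝ limitProfile (Ioi 0) := by
  intro y hy
  have hy0 : 0 < y := hy
  have hx := xiInf_pos hy0
  have ha : AnalyticAt ℝ xiInf y := by
    have := analyticAt_xiInf hx
    rwa [psiInf_xiInf hy0] at this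
  unfold limitProfile
  exact (ha.deriv.div (ha.mul analyticAt_id) (mul_ne_zero hx.ne' hy0.ne')).add
    (ha.deriv.div (analyticAt_const.mul analyticAt_id) (mul_ne_zero two_ne_zero hy0.ne'))

theorem tendsto_xiInf_atTop : Tendsto xiInf atTop atTop := by
  refine tendsto_atTop.2 fun K => ?_
  filter_upwards [eventually_gt_atTop 0, eventually_gt_atTop (psiInf (max K 1))] with y hy hy1
  exact (le_max_left _ _).trans ((lt_xiInf_iff (by positivity) hy).2 hy1).le

theorem tendsto_xiInf_zero : Tendsto xiInf (𝓝[>] 0) (𝓝[>] 0) := by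
  refine tendsto_nhdsWithin_iff.2 ⟨?_, ?_⟩
  · rw [tendsto_order]
    refine ⟨fun a ha => ?_, fun a ha => ?_⟩
    · filter_upwards [self_mem_nhdsWithin] with y hy using ha.trans (xiInf_pos hy)
    · filter_upwards [self_mem_nhdsWithin, nhdsWithin_le_nhds (gt_mem_nhds (psiInf_pos ha))]
        with y hy hy1 using (xiInf_lt_iff ha hy).2 hy1
  · filter_upwards [self_mem_nhdsWithin] with y hy using xiInf_pos hy

theorem tendsto_limitProfile_atTop : Tendsto limitProfile atTop (𝓝 (1 / 4)) := by
  have h : Tendsto (fun x : ℝ => (x⁻¹ + 1 / 2) / (psiInf x / √x * (√x * psiDeriv x))) atTop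
      (𝓝 ((0 + 1 / 2) / (2 * 1))) :=
    (tendsto_inv_atTop_zero.add_const _).div
      (tendsto_psiInf_div_sqrt.mul tendsto_sqrt_mul_psiDeriv) (by norm_num)
  norm_num at h
  norm_num
  refine (h.comp tendsto_xiInf_atTop).congr' ?_
  filter_upwards [eventually_gt_atTop 0] with y hy
  have hx := xiInf_pos hy
  have h2 := psiDeriv_pos hx.le
  rw [limitProfile_eq hy]
  simp only [Function.comp]
  rw [psiInf_xiInf hy]
  have : 0 < √(xiInf y) := by positivity
  field_simp

/-- Writing ψ_∞ = x A(x) with A analytic at 0, the remainder becomes J(x) / (x ψ_∞' A²) with the J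
of the proof. Everything rests on J(0) = 0; then J(x)/x tends to J'(0). -/
theorem exists_tendsto_remainder : ∃ L : ℝ, Tendsto (fun x => (1 / x + 1 / 2) /
    (psiInf x * psiDeriv x) - 1 / psiInf x ^ 2 - 1 / √Real.pi * (1 / psiInf x)) (𝓝[>] 0) (𝓝 L) := by
  obtain ⟨A, hA, hAeq⟩ := (natCast_le_analyticOrderAt
    (analyticAt_psiInf (x := 0) (by norm_num)) (n := 1)).1
    ((natCast_le_analyticOrderAt_iff_iteratedDeriv_eq_zero
      (analyticAt_psiInf (x := 0) (by norm_num))).2 (by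
        intro i hi
        obtain rfl : i = 0 := by omega
        simp [psiInf_zero]))
  have hA' : AnalyticAt ℝ (deriv A) 0 := hA.deriv
  have hAeq' : ∀ᶠ x in 𝓝 (0 : ℝ), psiInf x = x * A x := by
    filter_upwards [hAeq] with x hx
    simpa using hx
  have hD : ∀ᶠ x in 𝓝 (0 : ℝ), psiDeriv x = A x + x * deriv A x := by
    filter_upwards [hAeq'.eventually_nhds, hA.eventually_analyticAt,
      lt_mem_nhds (show (-2 : ℝ) < 0 by norm_num)] with x hx hax hx2
    have h1 := ((hasDerivAt_id x).mul hax.differentiableAt.hasDerivAt).congr_of_eventuallyEq hx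
    have := (hasDerivAt_psiInf hx2).unique h1
    simpa using this
  have hA0 : A 0 = √Real.pi / √2 := by
    rw [← psiDeriv_zero, hD.self_of_nhds]; simp
  have hdA0 : 2 * deriv A 0 = -(√Real.pi * (1 - 1 / √2)) := by
    have h1 := (hA.differentiableAt.hasDerivAt.add
      ((hasDerivAt_id (0 : ℝ)).mul hA'.differentiableAt.hasDerivAt)).congr_of_eventuallyEq hD
    have := hasDerivAt_psiDeriv_zero.unique h1
    rw [this]
    simp
    ring
  set J : ℝ → ℝ := fun x => A x / 2 - deriv A x - A x ^ 2 / √Real.pi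
    - x * A x * deriv A x / √Real.pi with hJdef
  have hs2 : √2 ^ 2 = (2 : ℝ) := Real.sq_sqrt (by norm_num)
  have hspi : √Real.pi ≠ 0 := by positivity
  -- Here the coefficient 1/√π is forced: A(0)/2 - A'(0) and A(0)²/√π both equal √π/2.
  have hJ0 : J 0 = 0 := by
    simp only [hJdef, hA0]
    have h2 : (√2 : ℝ) ≠ 0 := by positivity
    field_simp
    field_simp at hdA0
    linear_combination -√2 * hdA0 + √Real.pi * hs2
  have hJ : DifferentiableAt ℝ J 0 := by
    have h1 := hA.differentiableAt
    have h2 := hA'.differentiableAt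
    fun_prop
  have hslope : Tendsto (fun x => J x / x) (𝓝[>] 0) (𝓝 (deriv J 0)) := by
    have := (hasDerivAt_iff_tendsto_slope.1 hJ.hasDerivAt).mono_left
      (nhdsWithin_mono 0 (fun x (hx : 0 < x) => ne_of_gt hx))
    refine this.congr fun x => ?_
    simp [slope_def_field, hJ0]
  have hden : Tendsto (fun x => psiDeriv x * A x ^ 2) (𝓝[>] 0) (𝓝 (psiDeriv 0 * A 0 ^ 2)) :=
    (hasDerivAt_psiDeriv_zero.continuousAt.mul (hA.continuousAt.pow 2)).tendsto.mono_left
      nhdsWithin_le_nhds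
  have hA0pos : 0 < A 0 := by rw [hA0]; positivity
  have hdenne : psiDeriv 0 * A 0 ^ 2 ≠ 0 := by
    have := psiDeriv_pos (le_refl 0)
    positivity
  refine ⟨_, (hslope.div hden hdenne).congr' ?_⟩
  filter_upwards [self_mem_nhdsWithin, nhdsWithin_le_nhds hAeq', nhdsWithin_le_nhds hD]
    with x hx h1 h2
  have hx0 : 0 < x := hx
  have h3 := psiDeriv_pos hx0.le
  have h4 : A x ≠ 0 := by
    intro h
    have := psiInf_pos hx0
    rw [h1, h] at this
    simp at this
  have h5 : deriv A x = (psiDeriv x - A x) / x := by rw [h2]; field_simp; ring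
  simp only [Pi.div_apply, hJdef, h1, h5]
  field_simp
  ring

theorem exists_continuousOn_remainder :
    ∃ Φ₀ : ℝ → ℝ, ContinuousOn Φ₀ (Ici 0) ∧ ∀ ψ : ℝ, 0 < ψ →
      limitProfile ψ = 1 / ψ ^ 2 + 1 / √Real.pi * (1 / ψ) + Φ₀ ψ := by
  obtain ⟨L, hL⟩ := exists_tendsto_remainder
  have hlim : Tendsto (fun ψ => limitProfile ψ - 1 / ψ ^ 2 - 1 / √Real.pi * (1 / ψ))
      (𝓝[>] 0) (𝓝 L) := by
    refine (hL.comp tendsto_xiInf_zero).congr' ?_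
    filter_upwards [self_mem_nhdsWithin] with y hy
    have hy0 : 0 < y := hy
    simp only [Function.comp]
    rw [psiInf_xiInf hy0, limitProfile_eq hy0]
  refine ⟨Function.update (fun ψ => limitProfile ψ - 1 / ψ ^ 2 - 1 / √Real.pi * (1 / ψ)) 0 L,
    ?_, ?_⟩
  · intro y hy
    rcases (mem_Ici.1 hy).eq_or_lt with rfl | hy0
    · rw [continuousWithinAt_update_same, Ici_sdiff_left]
      exact hlim
    · refine ContinuousAt.continuousWithinAt ?_
      rw [continuousAt_update_of_ne hy0.ne']
      have h1 := (analyticOnNhd_limitProfile y hy0).continuousAt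
      have h2 : y ≠ 0 := hy0.ne'
      exact (h1.sub (continuousAt_const.div (by fun_prop) (by positivity))).sub
        (continuousAt_const.mul (continuousAt_const.div (by fun_prop) h2))
  · intro y hy
    rw [Function.update_of_ne hy.ne']
    ring

/-! ### The rescaled deviation angle and its limit as ε → 0 -/

/-- The rescaled expression `(1 - u²) / ε` at `u = e^{-εζ}`. -/
def scaledGap (ε ζ : ℝ) : ℝ := (1 - Real.exp (-(2 * ε * ζ))) / ε

/-- The weight of the rescaled deviation angle for `s = 1 + 1 / ε`. -/
def scaledWeight (ε ζ : ℝ) : ℝ :=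
  Real.exp (-(ε * ζ)) * (1 - Real.exp (-ζ)) / (scaledGap ε ζ * √(scaledGap ε ζ))

/-- The ratio entering the rescaled deviation angle for `s = 1 + 1 / ε`. -/
def scaledRatio (ε ζ : ℝ) : ℝ := (1 - Real.exp (-ζ)) / scaledGap ε ζ

theorem measurable_scaledGap (ε : ℝ) : Measurable (scaledGap ε) := by
  unfold scaledGap; fun_prop

theorem measurable_scaledWeight (ε : ℝ) : Measurable (scaledWeight ε) := by
  have := measurable_scaledGap ε
  unfold scaledWeight; fun_prop

theorem measurable_scaledRatio (ε : ℝ) : Measurable (scaledRatio ε) := by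
  have := measurable_scaledGap ε
  unfold scaledRatio; fun_prop

theorem scaledGap_pos {ε ζ : ℝ} (hε : 0 < ε) (hζ : 0 < ζ) : 0 < scaledGap ε ζ :=
  div_pos (one_sub_exp_neg_pos (by positivity)) hε

theorem scaledWeight_pos {ε ζ : ℝ} (hε : 0 < ε) (hζ : 0 < ζ) : 0 < scaledWeight ε ζ := by
  have h1 := scaledGap_pos hε hζ
  have h2 := one_sub_exp_neg_pos hζ
  unfold scaledWeight
  positivity

theorem scaledRatio_mem {ε : ℝ} (hε : 0 < ε) (hε2 : ε ≤ 1 / 2) (ζ : ℝ) (hζ : 0 < ζ) :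
    0 < scaledRatio ε ζ ∧ scaledRatio ε ζ ≤ 1 / 2 := by
  have h1 := scaledGap_pos hε hζ
  have h2 := one_sub_exp_neg_pos hζ
  refine ⟨div_pos h2 h1, ?_⟩
  rw [scaledRatio, div_le_iff₀ h1, scaledGap, ← mul_div_assoc, le_div_iff₀ hε]
  -- Bernoulli's inequality for the exponent 2ε ≤ 1 applied to (e^{-ζ})^(2ε); this is where ε ≤ 1/2,
  -- that is s ≥ 3, enters.
  have hb := rpow_one_add_le_one_add_mul_self (s := Real.exp (-ζ) - 1) (p := 2 * ε)
    (by linarith [Real.exp_pos (-ζ)]) (by positivity) (by linarith)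
  rw [add_sub_cancel, ← Real.exp_mul] at hb
  have : -ζ * (2 * ε) = -(2 * ε * ζ) := by ring
  rw [this] at hb
  linarith

/-- From 1 - e^{-3a} ≥ 1 - e^{-a} ≥ a e^{-a} with a = 2εζ/3. The third is chosen so that the power
3/2 of the bound carries exactly e^{-εζ}, cancelling that factor of `scaledWeight` and giving a
majorant independent of ε. -/
theorem mul_exp_le_scaledGap {ε ζ : ℝ} (hε : 0 < ε) (hζ : 0 < ζ) :
    2 * ζ / 3 * Real.exp (-(2 * ε * ζ / 3)) ≤ scaledGap ε ζ := by
  rw [scaledGap, le_div_iff₀ hε]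
  have h1 := Real.add_one_le_exp (2 * ε * ζ / 3)
  have h2 : Real.exp (2 * ε * ζ / 3) * Real.exp (-(2 * ε * ζ / 3)) = 1 := by
    rw [← Real.exp_add, add_neg_cancel, Real.exp_zero]
  have h3 : Real.exp (-(2 * ε * ζ)) ≤ Real.exp (-(2 * ε * ζ / 3)) := by
    apply Real.exp_le_exp.2
    have : 0 < ε * ζ := by positivity
    linarith
  have h4 := mul_le_mul_of_nonneg_right h1 (Real.exp_pos (-(2 * ε * ζ / 3))).le
  rw [h2] at h4
  linarith

theorem scaledWeight_le {ε ζ : ℝ} (hε : 0 < ε) (hζ : 0 < ζ) :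
    scaledWeight ε ζ ≤ 3 * √3 * majorant ζ := by
  have h2 := one_sub_exp_neg_pos hζ
  have hg := mul_exp_le_scaledGap hε hζ
  have hsq : √(2 * ζ / 3 * Real.exp (-(2 * ε * ζ / 3))) =
      √(2 * ζ) / √3 * Real.exp (-(ε * ζ / 3)) := by
    rw [Real.sqrt_mul (by positivity), Real.sqrt_div (by positivity)]
    congr 1
    have : Real.exp (-(2 * ε * ζ / 3)) = Real.exp (-(ε * ζ / 3)) ^ 2 := by
      rw [← Real.exp_nat_mul]
      push_cast
      ring_nf
    rw [this, Real.sqrt_sq (Real.exp_pos _).le]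
  have hexp : Real.exp (-(2 * ε * ζ / 3)) * Real.exp (-(ε * ζ / 3)) = Real.exp (-(ε * ζ)) := by
    rw [← Real.exp_add]
    ring_nf
  calc scaledWeight ε ζ ≤ Real.exp (-(ε * ζ)) * (1 - Real.exp (-ζ)) /
        (2 * ζ / 3 * Real.exp (-(2 * ε * ζ / 3)) * √(2 * ζ / 3 * Real.exp (-(2 * ε * ζ / 3)))) := by
        have := (scaledGap_pos hε hζ).le
        unfold scaledWeight
        gcongr
    _ = Real.exp (-(ε * ζ)) * (1 - Real.exp (-ζ)) /
        (2 * ζ / 3 * (√(2 * ζ) / √3) * Real.exp (-(ε * ζ))) := by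
        rw [hsq, ← hexp]; congr 1; ring
    _ = 3 * √3 * limWeight ζ := by
        rw [limWeight]
        have := Real.exp_pos (-(ε * ζ))
        have hq : 0 < √(2 * ζ) := by positivity
        field_simp
    _ ≤ _ := by gcongr; exact limWeight_le_majorant hζ

theorem integrableOn_scaledWeight {ε : ℝ} (hε : 0 < ε) :
    IntegrableOn (scaledWeight ε) (Ioi 0) := by
  refine Integrable.mono' (integrableOn_majorant.const_mul (3 * √3))
    (measurable_scaledWeight ε).aestronglyMeasurable ?_
  filter_upwards [ae_restrict_mem measurableSet_Ioi] with ζ hζ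
  rw [Real.norm_of_nonneg (scaledWeight_pos hε hζ).le]
  exact scaledWeight_le hε hζ

theorem tendsto_scaledGap (ζ : ℝ) : Tendsto (fun ε => scaledGap ε ζ) (𝓝[>] 0) (𝓝 (2 * ζ)) := by
  have h : HasDerivAt (fun ε : ℝ => 1 - Real.exp (-(2 * ε * ζ))) (2 * ζ) 0 := by
    have := hasDerivAt_one_sub_exp (2 * ζ) 0
    simp only [mul_zero, neg_zero, Real.exp_zero, mul_one] at this
    refine this.congr_of_eventuallyEq (Eventually.of_forall fun ε => ?_)
    ring_nf
  have := (hasDerivAt_iff_tendsto_slope.1 h).mono_left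
    (nhdsWithin_mono 0 (fun x (hx : 0 < x) => ne_of_gt hx))
  refine this.congr fun ε => ?_
  simp [slope_def_field, scaledGap]

theorem tendsto_scaledWeight {ζ : ℝ} (hζ : 0 < ζ) :
    Tendsto (fun ε => scaledWeight ε ζ) (𝓝[>] 0) (𝓝 (limWeight ζ)) := by
  have h1 := tendsto_scaledGap ζ
  have h2 : Tendsto (fun ε : ℝ => Real.exp (-(ε * ζ))) (𝓝[>] 0) (𝓝 1) := by
    have : Continuous fun ε : ℝ => Real.exp (-(ε * ζ)) := by fun_prop
    simpa using (this.tendsto 0).mono_left nhdsWithin_le_nhds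
  have := (h2.mul_const (1 - Real.exp (-ζ))).div
    (h1.mul ((Real.continuous_sqrt.tendsto _).comp h1)) (by positivity)
  rw [one_mul] at this
  exact this

theorem tendsto_scaledRatio {ζ : ℝ} (hζ : 0 < ζ) :
    Tendsto (fun ε => scaledRatio ε ζ) (𝓝[>] 0) (𝓝 (limRatio ζ)) :=
  tendsto_const_nhds.div (tendsto_scaledGap ζ) (by positivity)

/-- Dominated convergence jointly in ε and x. Near x₀ > 0 the square root is at least 1, so a bound
on φ there suffices. -/
theorem tendsto_integral_scaled {φ : ℝ → ℝ} (hφm : Measurable φ)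
    (hφc : ContinuousOn φ (Ioi 0)) (hφ : ∀ s, 1 ≤ s → |φ s| ≤ 1) {x₀ : ℝ} (hx₀ : 0 < x₀) :
    Tendsto (fun q : ℝ × ℝ => ∫ ζ in Ioi (0 : ℝ),
        scaledWeight q.1 ζ * φ (√(1 + q.2 * scaledRatio q.1 ζ))) (𝓝[>] 0 ×ˢ 𝓝 x₀)
      (𝓝 (∫ ζ in Ioi (0 : ℝ), limWeight ζ * φ (√(1 + x₀ * limRatio ζ)))) := by
  refine tendsto_integral_filter_of_dominated_convergence (fun ζ => 3 * √3 * majorant ζ) ?_ ?_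
    (integrableOn_majorant.const_mul _) ?_
  · refine Eventually.of_forall fun q => Measurable.aestronglyMeasurable ?_
    have h1 := measurable_scaledWeight q.1
    have h2 := measurable_scaledRatio q.1
    fun_prop
  · have h1 : ∀ᶠ q : ℝ × ℝ in 𝓝[>] 0 ×ˢ 𝓝 x₀, 0 < q.1 := tendsto_fst.eventually self_mem_nhdsWithin
    have h2 : ∀ᶠ q : ℝ × ℝ in 𝓝[>] 0 ×ˢ 𝓝 x₀, 0 < q.2 := tendsto_snd.eventually (lt_mem_nhds hx₀)
    filter_upwards [h1, h2] with q hq1 hq2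
    filter_upwards [ae_restrict_mem measurableSet_Ioi] with ζ hζ
    have hζ0 : 0 < ζ := hζ
    have hr : 0 < scaledRatio q.1 ζ := div_pos (one_sub_exp_neg_pos hζ0) (scaledGap_pos hq1 hζ0)
    have hw := scaledWeight_pos hq1 hζ0
    rw [norm_mul, Real.norm_of_nonneg hw.le, Real.norm_eq_abs]
    refine (mul_le_of_le_one_right hw.le (hφ _ ?_)).trans (scaledWeight_le hq1 hζ0)
    rw [Real.one_le_sqrt]
    have := mul_pos hq2 hr
    linarith
  · filter_upwards [ae_restrict_mem measurableSet_Ioi] with ζ hζ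
    have hζ0 : 0 < ζ := hζ
    refine ((tendsto_scaledWeight hζ0).comp tendsto_fst).mul ?_
    have hm : Tendsto (fun q : ℝ × ℝ => q.2 * scaledRatio q.1 ζ) (𝓝[>] 0 ×ˢ 𝓝 x₀)
        (𝓝 (x₀ * limRatio ζ)) := tendsto_snd.mul ((tendsto_scaledRatio hζ0).comp tendsto_fst)
    have hs : Tendsto (fun q : ℝ × ℝ => √(1 + q.2 * scaledRatio q.1 ζ)) (𝓝[>] 0 ×ˢ 𝓝 x₀)
        (𝓝 (√(1 + x₀ * limRatio ζ))) :=
      (Real.continuous_sqrt.tendsto _).comp (hm.const_add 1)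
    have hpos : 0 < √(1 + x₀ * limRatio ζ) := by
      have := (limRatio_mem ζ hζ0).1
      positivity
    exact (hφc.continuousAt (Ioi_mem_nhds hpos)).tendsto.comp hs

/-- The rescaled deviation angle for `s = 1 + 1 / ε`. -/
def scaledAngle (ε : ℝ) : ℝ → ℝ := angleIntegral (scaledWeight ε) (scaledRatio ε)

/-- The derivative of `scaledAngle`. -/
def scaledAngleDeriv (ε : ℝ) : ℝ → ℝ := angleIntegralDeriv (scaledWeight ε) (scaledRatio ε)

theorem tendsto_scaledAngleDeriv {x₀ : ℝ} (hx₀ : 0 < x₀) :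
    Tendsto (fun q : ℝ × ℝ => scaledAngleDeriv q.1 q.2) (𝓝[>] 0 ×ˢ 𝓝 x₀) (𝓝 (psiDeriv x₀)) := by
  refine tendsto_integral_scaled (φ := fun s => 1 / s ^ 3) (by fun_prop) (fun s hs => ?_)
    (fun s hs => ?_) hx₀
  · have : s ≠ 0 := ne_of_gt hs
    fun_prop (disch := positivity)
  · rw [abs_of_nonneg (by positivity), div_le_one₀ (by positivity)]
    exact one_le_pow₀ hs

theorem tendsto_scaledAngle {x₀ : ℝ} (hx₀ : 0 < x₀) :
    Tendsto (fun ε => scaledAngle ε x₀) (𝓝[>] 0) (𝓝 (psiInf x₀)) := by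
  have h := (tendsto_integral_scaled (φ := fun s => 1 / (s * (1 + s))) (by fun_prop)
    (fun s hs => by
      have h0 : 0 < s := hs
      have : s * (1 + s) ≠ 0 := by positivity
      fun_prop (disch := positivity))
    (fun s hs => by
      rw [abs_of_nonneg (by positivity), div_le_one₀ (by positivity)]
      nlinarith) hx₀).const_mul (2 * x₀)
  have h2 := h.comp (tendsto_id.prodMk (tendsto_const_nhds (x := x₀) (f := 𝓝[>] (0 : ℝ))))
  rw [psiInf_eq, angleIntegral]
  convert! h2 using 1
  · ext ε
    simp only [Function.comp, scaledAngle, angleIntegral, id]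
    rw [← integral_const_mul]
    congr 1 with ζ
    ring
  · rw [← integral_const_mul]
    congr 2 with ζ
    ring

theorem hasDerivAt_scaledAngle {ε : ℝ} (hε : 0 < ε) (hε2 : ε ≤ 1 / 2) {x : ℝ} (hx : -2 < x) :
    HasDerivAt (scaledAngle ε) (scaledAngleDeriv ε x) x :=
  hasDerivAt_angleIntegral (integrableOn_scaledWeight hε) (measurable_scaledRatio ε)
    (scaledRatio_mem hε hε2) hx

theorem scaledAngleDeriv_pos {ε : ℝ} (hε : 0 < ε) (hε2 : ε ≤ 1 / 2) {x : ℝ} (hx : 0 ≤ x) :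
    0 < scaledAngleDeriv ε x :=
  angleIntegralDeriv_pos (integrableOn_scaledWeight hε) (measurable_scaledRatio ε)
    (scaledRatio_mem hε hε2) (fun _ => scaledWeight_pos hε) hx

theorem strictMonoOn_scaledAngle {ε : ℝ} (hε : 0 < ε) (hε2 : ε ≤ 1 / 2) :
    StrictMonoOn (scaledAngle ε) (Ioi 0) :=
  (strictMonoOn_angleIntegral (integrableOn_scaledWeight hε) (measurable_scaledRatio ε)
    (scaledRatio_mem hε hε2) (fun _ => scaledWeight_pos hε)).mono Ioi_subset_Ici_self

theorem hasStrictDerivAt_scaledAngle {ε : ℝ} (hε : 0 < ε) (hε2 : ε ≤ 1 / 2) {x : ℝ} (hx : -2 < x) :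
    HasStrictDerivAt (scaledAngle ε) (scaledAngleDeriv ε x) x := by
  have := (analyticAt_angleIntegral (integrableOn_scaledWeight hε) (measurable_scaledRatio ε)
    (scaledRatio_mem hε hε2) hx).hasStrictDerivAt
  rwa [(hasDerivAt_angleIntegral (integrableOn_scaledWeight hε) (measurable_scaledRatio ε)
    (scaledRatio_mem hε hε2) hx).deriv] at this

/-! ### Change of variables from the impact parameter to x -/

theorem turningPoint_eq {s β x : ℝ} (hs : 1 < s) (hβ : 0 < β) (hx : 0 < x)
    (h : 1 - x ^ 2 - (x / β) ^ (s - 1) = 0) : turningPoint s β = x := by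
  have : {x : ℝ | 0 < x ∧ 1 - x ^ 2 - (x / β) ^ (s - 1) = 0} = {x} := by
    ext y
    simp only [mem_ofPred_eq, mem_singleton_iff]
    refine ⟨fun ⟨hy, hy1⟩ => ?_, fun hy => hy ▸ ⟨hx, h⟩⟩
    have hlt : ∀ a b : ℝ, 0 < a → a < b → a ^ 2 + (a / β) ^ (s - 1) < b ^ 2 + (b / β) ^ (s - 1) := by
      intro a b ha hab
      have h1 : (a / β) ^ (s - 1) < (b / β) ^ (s - 1) :=
        Real.rpow_lt_rpow (by positivity) (by gcongr) (by linarith)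
      have h2 : a ^ 2 < b ^ 2 := by gcongr
      linarith
    rcases lt_trichotomy y x with hyx | hyx | hyx
    · linarith [hlt y x hy hyx]
    · exact hyx
    · linarith [hlt x y hx hyx]
  rw [turningPoint, this, csSup_singleton]

/-- The impact parameter as a function of the rescaled parameter `x`, for `s = 1 + 1 / ε`. -/
def scaledImpact (ε x : ℝ) : ℝ := (1 + ε * x) ^ (ε - 1 / 2) * (ε * x) ^ (-ε)

theorem scaledImpact_pos {ε x : ℝ} (hε : 0 < ε) (hx : 0 < x) : 0 < scaledImpact ε x := by
  unfold scaledImpact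
  positivity

theorem inv_sqrt_div_scaledImpact {ε x : ℝ} (hε : 0 < ε) (hx : 0 < x) :
    1 / √(1 + ε * x) / scaledImpact ε x = (ε * x / (1 + ε * x)) ^ ε := by
  have h1 : 0 < 1 + ε * x := by positivity
  rw [scaledImpact, Real.div_rpow (by positivity) h1.le, Real.rpow_sub h1, ← Real.sqrt_eq_rpow,
    Real.rpow_neg (by positivity)]
  have : 0 < (1 + ε * x) ^ ε := by positivity
  have : 0 < (ε * x) ^ ε := by positivity
  field_simp

theorem inv_sqrt_div_scaledImpact_rpow {ε x : ℝ} (hε : 0 < ε) (hx : 0 < x) :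
    (1 / √(1 + ε * x) / scaledImpact ε x) ^ (1 / ε) = ε * x / (1 + ε * x) := by
  rw [inv_sqrt_div_scaledImpact hε hx, ← Real.rpow_mul (by positivity), mul_one_div_cancel hε.ne',
    Real.rpow_one]

theorem turningPoint_scaledImpact {ε x : ℝ} (hε : 0 < ε) (hx : 0 < x) :
    turningPoint (1 + 1 / ε) (scaledImpact ε x) = 1 / √(1 + ε * x) := by
  have h1 : 0 < 1 + ε * x := by positivity
  refine turningPoint_eq (by simpa using hε) (scaledImpact_pos hε hx) (by positivity) ?_
  rw [add_sub_cancel_left, inv_sqrt_div_scaledImpact_rpow hε hx, div_pow, Real.sq_sqrt h1.le]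
  field_simp
  ring

theorem image_mul_exp_neg {c ε : ℝ} (hc : 0 < c) (hε : 0 < ε) :
    (fun ζ : ℝ => c * Real.exp (-(ε * ζ))) '' Ioi 0 = Ioo 0 c := by
  ext y
  constructor
  · rintro ⟨ζ, hζ, rfl⟩
    have hζ0 : 0 < ζ := hζ
    refine ⟨by positivity, mul_lt_of_lt_one_right hc ?_⟩
    rw [Real.exp_lt_one_iff]
    have := mul_pos hε hζ0
    linarith
  · rintro ⟨h0, h1⟩
    refine ⟨-Real.log (y / c) / ε, ?_, ?_⟩
    · have := Real.log_neg (div_pos h0 hc) ((div_lt_one hc).2 h1)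
      exact div_pos (by linarith) hε
    · have : -(ε * (-Real.log (y / c) / ε)) = Real.log (y / c) := by field_simp
      beta_reduce
      rw [this, Real.exp_log (div_pos h0 hc)]
      field_simp

/-- Under y = x₀ e^{-εζ} the power (y/β)^(1/ε) becomes a multiple of e^{-ζ}, which makes the
singular limit s → ∞ regular. -/
theorem apseAngle_scaledImpact {ε x : ℝ} (hε : 0 < ε) (hx : 0 < x) :
    apseAngle (1 + 1 / ε) (scaledImpact ε x) = ∫ ζ in Ioi (0 : ℝ),
      √ε * Real.exp (-(ε * ζ)) / √(scaledGap ε ζ + x * (1 - Real.exp (-ζ))) := by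
  have h1 : 0 < 1 + ε * x := by positivity
  have hc : 0 < 1 / √(1 + ε * x) := by positivity
  rw [apseAngle, turningPoint_scaledImpact hε hx, intervalIntegral.integral_of_le hc.le,
    integral_Ioc_eq_integral_Ioo, ← image_mul_exp_neg hc hε,
    integral_image_eq_integral_abs_deriv_smul measurableSet_Ioi
      (f' := fun ζ => 1 / √(1 + ε * x) * (-ε * Real.exp (-(ε * ζ)))) ?_ ?_]
  · refine setIntegral_congr_fun measurableSet_Ioi fun ζ hζ => ?_
    have hζ0 : 0 < ζ := hζ
    have hg := scaledGap_pos hε hζ0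
    have hr := one_sub_exp_neg_pos hζ0
    have hpow : (1 / √(1 + ε * x) * Real.exp (-(ε * ζ)) / scaledImpact ε x) ^ (1 / ε)
        = ε * x / (1 + ε * x) * Real.exp (-ζ) := by
      rw [mul_div_right_comm, Real.mul_rpow (by have := scaledImpact_pos hε hx; positivity)
        (Real.exp_pos _).le, inv_sqrt_div_scaledImpact_rpow hε hx, ← Real.exp_mul]
      congr 2
      field_simp
    have hexp : Real.exp (-(ε * ζ)) ^ 2 = Real.exp (-(2 * ε * ζ)) := by
      rw [← Real.exp_nat_mul]
      push_cast
      ring_nf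
    have hin : 1 - (1 / √(1 + ε * x) * Real.exp (-(ε * ζ))) ^ 2 -
        ε * x / (1 + ε * x) * Real.exp (-ζ) =
        ε * (scaledGap ε ζ + x * (1 - Real.exp (-ζ))) / (1 + ε * x) := by
      rw [mul_pow, div_pow, Real.sq_sqrt h1.le, hexp, scaledGap]
      field_simp
      ring
    simp only [add_sub_cancel_left, smul_eq_mul]
    rw [hpow, hin, Real.sqrt_div (by positivity), Real.sqrt_mul hε.le, neg_mul, mul_neg, abs_neg,
      abs_of_pos (by positivity)]
    have hse : √ε ^ 2 = ε := Real.sq_sqrt hε.le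
    have h3 : 0 < √(scaledGap ε ζ + x * (1 - Real.exp (-ζ))) := by positivity
    field_simp
    rw [hse]
  · intro ζ _
    have := ((((hasDerivAt_id ζ).const_mul ε).neg).exp).const_mul (1 / √(1 + ε * x))
    refine (this.congr_deriv ?_).hasDerivWithinAt
    simp only [id, Pi.neg_apply]
    ring
  · intro a _ b _ hab
    have := mul_left_cancel₀ hc.ne' hab
    have := Real.exp_injective this
    have := neg_injective this
    exact mul_left_cancel₀ hε.ne' this

/-- The free orbit x = 0, with primitive -arcsin(e^{-εζ}). It represents π/2 as an integral that can
be subtracted from φ₀ under one integral sign. -/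
theorem integral_scaledGap {ε : ℝ} (hε : 0 < ε) :
    IntegrableOn (fun ζ => √ε * Real.exp (-(ε * ζ)) / √(scaledGap ε ζ)) (Ioi 0) ∧
    ∫ ζ in Ioi (0 : ℝ), √ε * Real.exp (-(ε * ζ)) / √(scaledGap ε ζ) = Real.pi / 2 := by
  have hcont : ContinuousWithinAt (fun ζ : ℝ => -Real.arcsin (Real.exp (-(ε * ζ)))) (Ici 0) 0 :=
    Continuous.continuousWithinAt (by fun_prop)
  have hderiv : ∀ ζ ∈ Ioi (0 : ℝ), HasDerivAt (fun ζ : ℝ => -Real.arcsin (Real.exp (-(ε * ζ))))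
      (√ε * Real.exp (-(ε * ζ)) / √(scaledGap ε ζ)) ζ := by
    intro ζ hζ
    have hζ0 : 0 < ζ := hζ
    have hlt : Real.exp (-(ε * ζ)) < 1 := by
      rw [Real.exp_lt_one_iff]
      have := mul_pos hε hζ0
      linarith
    have hpos := Real.exp_pos (-(ε * ζ))
    have h1 := ((hasDerivAt_id ζ).const_mul ε).neg.exp
    have h2 := (Real.hasDerivAt_arcsin (x := Real.exp (-(ε * ζ))) (by linarith) hlt.ne).comp ζ h1
    refine h2.neg.congr_deriv ?_
    have hexp : Real.exp (-(ε * ζ)) ^ 2 = Real.exp (-(2 * ε * ζ)) := by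
      rw [← Real.exp_nat_mul]
      push_cast
      ring_nf
    have hin : 1 - Real.exp (-(ε * ζ)) ^ 2 = ε * scaledGap ε ζ := by
      rw [hexp, scaledGap]
      field_simp
    have hg := scaledGap_pos hε hζ0
    rw [hin, Real.sqrt_mul hε.le]
    have hse : √ε ^ 2 = ε := Real.sq_sqrt hε.le
    have : 0 < √(scaledGap ε ζ) := by positivity
    simp
    field_simp
    exact hse.symm
  have hnn : ∀ ζ ∈ Ioi (0 : ℝ), 0 ≤ √ε * Real.exp (-(ε * ζ)) / √(scaledGap ε ζ) :=
    fun ζ _ => by positivity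
  have hlim : Tendsto (fun ζ : ℝ => -Real.arcsin (Real.exp (-(ε * ζ)))) atTop (𝓝 0) := by
    have h1 : Tendsto (fun ζ : ℝ => Real.exp (-(ε * ζ))) atTop (𝓝 0) :=
      Real.tendsto_exp_neg_atTop_nhds_zero.comp (tendsto_id.const_mul_atTop hε)
    have h2 := ((Real.continuous_arcsin.tendsto 0).comp h1).neg
    simpa using h2
  refine ⟨integrableOn_Ioi_deriv_of_nonneg hcont hderiv hnn hlim, ?_⟩
  rw [integral_Ioi_of_hasDerivAt_of_nonneg hcont hderiv hnn hlim]
  simp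

theorem deviationAngle_scaledImpact {ε x : ℝ} (hε : 0 < ε) (hx : 0 < x) :
    deviationAngle (1 + 1 / ε) (scaledImpact ε x) = √ε * scaledAngle ε x := by
  obtain ⟨hint, hval⟩ := integral_scaledGap hε
  have hint2 : IntegrableOn (fun ζ => √ε * Real.exp (-(ε * ζ)) /
      √(scaledGap ε ζ + x * (1 - Real.exp (-ζ)))) (Ioi 0) := by
    refine Integrable.mono' hint ?_ ?_
    · have := measurable_scaledGap ε
      exact Measurable.aestronglyMeasurable (by fun_prop)
    · filter_upwards [ae_restrict_mem measurableSet_Ioi] with ζ hζ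
      have hζ0 : 0 < ζ := hζ
      have hg := scaledGap_pos hε hζ0
      have hr := one_sub_exp_neg_pos hζ0
      rw [Real.norm_of_nonneg (by positivity)]
      gcongr
      have := mul_pos hx hr
      linarith
  have hpi : Real.pi = 2 * (Real.pi / 2) := by ring
  rw [deviationAngle, apseAngle_scaledImpact hε hx]
  nth_rewrite 1 [hpi]
  rw [← hval, ← mul_sub, ← integral_sub hint hint2, scaledAngle, angleIntegral,
    ← integral_const_mul, ← integral_const_mul]
  refine setIntegral_congr_fun measurableSet_Ioi fun ζ hζ => ?_
  have hζ0 : 0 < ζ := hζ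
  have hg := scaledGap_pos hε hζ0
  have hr := one_sub_exp_neg_pos hζ0
  have hsum : scaledGap ε ζ + x * (1 - Real.exp (-ζ)) =
      scaledGap ε ζ * (1 + x * scaledRatio ε ζ) := by
    rw [scaledRatio]
    field_simp
  have hr2 : 0 < scaledRatio ε ζ := div_pos hr hg
  have ht : 0 < √(1 + x * scaledRatio ε ζ) := by positivity
  have hts : √(1 + x * scaledRatio ε ζ) ^ 2 = 1 + x * scaledRatio ε ζ :=
    Real.sq_sqrt (by positivity)
  have hxr : x * (1 - Real.exp (-ζ)) =
      scaledGap ε ζ * (√(1 + x * scaledRatio ε ζ) ^ 2 - 1) := by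
    rw [hts, scaledRatio]
    field_simp
    ring
  rw [hsum, Real.sqrt_mul hg.le, scaledWeight]
  generalize √(1 + x * scaledRatio ε ζ) = t at *
  have hq : 0 < √(scaledGap ε ζ) := by positivity
  field_simp
  linear_combination -hxr

/-- The turning point y of β exists by the intermediate value theorem, and x is found by solving y =
(1 + εx)^(-1/2). -/
theorem exists_scaledImpact_eq {ε β : ℝ} (hε : 0 < ε) (hβ : 0 < β) :
    ∃ x, 0 < x ∧ scaledImpact ε x = β := by
  have hcont : ContinuousOn (fun y : ℝ => y ^ 2 + (y / β) ^ (1 / ε)) (Icc 0 1) := by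
    refine (Continuous.continuousOn ?_)
    exact (continuous_pow 2).add
      ((continuous_id.div_const β).rpow_const fun _ => Or.inr (by positivity))
  have hpow1 : 0 < (1 / β) ^ (1 / ε) := by positivity
  obtain ⟨y, hy, hyv⟩ := intermediate_value_Ioo zero_le_one hcont
    (show (1 : ℝ) ∈ Ioo _ _ from ⟨by
      have : (1 / ε) ≠ 0 := by positivity
      simp [hε.ne'], by
      linarith⟩)
  have hy0 : 0 < y := hy.1
  have hy1 : 0 < 1 - y ^ 2 := by nlinarith [hy.2]
  have hB : 1 + ε * ((1 - y ^ 2) / y ^ 2 / ε) = 1 / y ^ 2 := by field_simp; ring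
  have hx : 0 < (1 - y ^ 2) / y ^ 2 / ε := by positivity
  refine ⟨(1 - y ^ 2) / y ^ 2 / ε, hx, ?_⟩
  have h1 := inv_sqrt_div_scaledImpact hε hx
  have h2 : 1 / √(1 + ε * ((1 - y ^ 2) / y ^ 2 / ε)) = y := by
    rw [hB, Real.sqrt_div zero_le_one, Real.sqrt_one, Real.sqrt_sq hy0.le, one_div_one_div]
  have h3 : ε * ((1 - y ^ 2) / y ^ 2 / ε) / (1 + ε * ((1 - y ^ 2) / y ^ 2 / ε)) = 1 - y ^ 2 := by
    rw [hB]
    field_simp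
  have h4 : 1 - y ^ 2 = (y / β) ^ (1 / ε) := by
    have : y ^ 2 + (y / β) ^ (1 / ε) = 1 := hyv
    linarith
  have h5 : (1 - y ^ 2) ^ ε = y / β := by
    rw [h4, ← Real.rpow_mul (by positivity), one_div_mul_cancel hε.ne', Real.rpow_one]
  rw [h2, h3, h5] at h1
  rw [div_eq_mul_inv, div_eq_mul_inv] at h1
  exact inv_injective (mul_left_cancel₀ hy0.ne' h1)

/-! ### The collision kernel in the parameter x -/

/-- The chosen preimage is itself some `scaledImpact ε z`, and injectivity of `scaledAngle ε` forces
z = x. -/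
theorem impactParameter_eq {ε x : ℝ} (hε : 0 < ε) (hε2 : ε ≤ 1 / 2) (hx : 0 < x) :
    impactParameter (1 + 1 / ε) (√ε * scaledAngle ε x) = scaledImpact ε x := by
  have hex : ∃ β ∈ Ioi (0 : ℝ), deviationAngle (1 + 1 / ε) β = √ε * scaledAngle ε x :=
    ⟨_, scaledImpact_pos hε hx, deviationAngle_scaledImpact hε hx⟩
  have h1 := Function.invFunOn_mem hex
  have h2 := Function.invFunOn_eq hex
  obtain ⟨z, hz, hzβ⟩ := exists_scaledImpact_eq hε h1
  rw [← hzβ, deviationAngle_scaledImpact hε hz] at h2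
  have h3 : scaledAngle ε z = scaledAngle ε x := mul_left_cancel₀ (by positivity) h2
  have h4 : z = x := (strictMonoOn_scaledAngle hε hε2).injOn hz hx h3
  rw [impactParameter, ← hzβ, h4]

theorem hasDerivAt_scaledImpact {ε x : ℝ} (hε : 0 < ε) (hx : 0 < x) :
    HasDerivAt (scaledImpact ε)
      (-(scaledImpact ε x * ε * ((1 / 2 - ε) / (1 + ε * x) + 1 / x))) x := by
  have h1 : 0 < 1 + ε * x := by positivity
  have h2 : 0 < ε * x := by positivity
  have d2 := (hasDerivAt_id x).const_mul ε
  have d1 := d2.const_add 1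
  have d := (d1.rpow_const (p := ε - 1 / 2) (Or.inl h1.ne')).mul
    (d2.rpow_const (p := -ε) (Or.inl h2.ne'))
  refine d.congr_deriv ?_
  simp only [id]
  rw [scaledImpact, Real.rpow_sub_one h1.ne', Real.rpow_sub_one h2.ne']
  field_simp
  ring

theorem hasDerivAt_impactParameter {ε x : ℝ} (hε : 0 < ε) (hε2 : ε ≤ 1 / 2) (hx : 0 < x) :
    HasDerivAt (impactParameter (1 + 1 / ε))
      (-(scaledImpact ε x * ε * ((1 / 2 - ε) / (1 + ε * x) + 1 / x)) *
        (√ε * scaledAngleDeriv ε x)⁻¹) (√ε * scaledAngle ε x) := by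
  have hse : 0 < √ε := by positivity
  have hmono : StrictMonoOn (fun x => √ε * scaledAngle ε x) (Ioi 0) :=
    (strictMono_mul_left_of_pos hse).comp_strictMonoOn (strictMonoOn_scaledAngle hε hε2)
  have hd : HasStrictDerivAt (fun x => √ε * scaledAngle ε x) (√ε * scaledAngleDeriv ε x) x :=
    (hasStrictDerivAt_scaledAngle hε hε2 (by linarith)).const_mul _
  have hne : √ε * scaledAngleDeriv ε x ≠ 0 :=
    (mul_pos hse (scaledAngleDeriv_pos hε hε2 hx.le)).ne'
  have hinv := hasDerivAt_invFunOn hmono hx hd hne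
  have hfx := invFunOn_apply_eq hmono hx
  have hβ := hasDerivAt_scaledImpact hε hx
  rw [← hfx] at hβ
  have hcomp := hβ.comp _ hinv
  rw [hfx] at hcomp
  refine hcomp.congr_of_eventuallyEq ?_
  filter_upwards [invFunOn_eventuallyEq_localInverse hmono hx hd hne] with y hy
  obtain ⟨-, hy0, hy1⟩ := hy
  have := impactParameter_eq hε hε2 hy0
  rw [hy1] at this
  exact this

theorem angularPart_eq {ε x : ℝ} (hε : 0 < ε) (hε2 : ε ≤ 1 / 2) (hx : 0 < x)
    (hθ : √ε * scaledAngle ε x ≤ Real.pi) :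
    angularPart (1 + 1 / ε) (Real.cos (√ε * scaledAngle ε x)) =
      2 ^ (4 * ε) * scaledImpact ε x ^ 2 * (scaledAngle ε x * Real.sinc (√ε * scaledAngle ε x))⁻¹ *
        ((1 / 2 - ε) / (1 + ε * x) + 1 / x) / scaledAngleDeriv ε x := by
  have hse : 0 < √ε := by positivity
  have hT : 0 < scaledAngle ε x := by
    have := strictMonoOn_angleIntegral (integrableOn_scaledWeight hε) (measurable_scaledRatio ε)
      (scaledRatio_mem hε hε2) (fun _ => scaledWeight_pos hε) self_mem_Ici hx.le hx
    rwa [angleIntegral_zero] at this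
  have hθ0 : 0 < √ε * scaledAngle ε x := by positivity
  have hT' := scaledAngleDeriv_pos hε hε2 hx.le
  have hβ := scaledImpact_pos hε hx
  have hK : 0 < (1 / 2 - ε) / (1 + ε * x) + 1 / x := by
    have : 0 ≤ 1 / 2 - ε := by linarith
    positivity
  rw [angularPart, Real.arccos_cos hθ0.le hθ, (hasDerivAt_impactParameter hε hε2 hx).deriv,
    impactParameter_eq hε hε2 hx, abs_mul, abs_neg, abs_of_pos (by positivity),
    abs_of_pos (by positivity), Real.sinc_of_ne_zero hθ0.ne']
  have h4 : 4 / (1 + 1 / ε - 1) = 4 * ε := by field_simp; ring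
  have hse2 : √ε ^ 2 = ε := Real.sq_sqrt hε.le
  rw [h4]
  generalize (1 / 2 - ε) / (1 + ε * x) + 1 / x = K
  -- The hypothesis allows θ = π; there both sides vanish by the convention for division by zero.
  by_cases hs : Real.sin (√ε * scaledAngle ε x) = 0
  · simp [hs]
  generalize Real.sin (√ε * scaledAngle ε x) = S at *
  field_simp
  linear_combination (-K) * hse2

/-! ### Passage to the limit s → ∞ -/

theorem tendsto_scaledImpact {x₀ : ℝ} (hx₀ : 0 < x₀) :
    Tendsto (fun q : ℝ × ℝ => scaledImpact q.1 q.2) (𝓝[>] 0 ×ˢ 𝓝 x₀) (𝓝 1) := by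
  have hε : Tendsto (fun q : ℝ × ℝ => q.1) (𝓝[>] 0 ×ˢ 𝓝 x₀) (𝓝[>] 0) := tendsto_fst
  have hε0 := tendsto_nhds_of_tendsto_nhdsWithin hε
  have hx : Tendsto (fun q : ℝ × ℝ => q.2) (𝓝[>] (0 : ℝ) ×ˢ 𝓝 x₀) (𝓝 x₀) := tendsto_snd
  have h1 : Tendsto (fun q : ℝ × ℝ => (1 + q.1 * q.2) ^ (q.1 - 1 / 2)) (𝓝[>] 0 ×ˢ 𝓝 x₀)
      (𝓝 ((1 + 0 * x₀) ^ (0 - 1 / 2 : ℝ))) :=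
    ((hε0.mul hx).const_add 1).rpow (hε0.sub_const _) (Or.inl (by simp))
  have hlog : Tendsto (fun t : ℝ => Real.log t * t) (𝓝[>] 0) (𝓝 0) := by
    simpa only [Real.rpow_one] using tendsto_log_mul_rpow_nhdsGT_zero one_pos
  have h2 : Tendsto (fun q : ℝ × ℝ => Real.exp (-(Real.log q.1 * q.1) - Real.log q.2 * q.1))
      (𝓝[>] 0 ×ˢ 𝓝 x₀) (𝓝 (Real.exp (-0 - Real.log x₀ * 0))) :=
    (Real.continuous_exp.tendsto _).comp
      (((hlog.comp hε).neg).sub ((hx.log hx₀.ne').mul hε0))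
  have h3 := h1.mul h2
  norm_num at h3
  refine h3.congr' ?_
  filter_upwards [hε.eventually self_mem_nhdsWithin, hx.eventually (lt_mem_nhds hx₀)] with q h4 h5
  have h4 : 0 < q.1 := h4
  rw [scaledImpact, Real.rpow_def_of_pos (mul_pos h4 h5) (-q.1), Real.log_mul h4.ne' h5.ne']
  norm_num
  left
  ring

/-- Convergence of T_ε at just two points a < ξ_∞(ψ) < b traps the preimage in (a, b), by the
intermediate value theorem and monotonicity; no uniform convergence is needed. -/
theorem tendsto_invFunOn_scaledAngle {ι : Type*} {l : Filter ι} {ε y : ι → ℝ} {ψ : ℝ} (hψ : 0 < ψ)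
    (hε : Tendsto ε l (𝓝[>] 0)) (hy : Tendsto y l (𝓝 ψ)) :
    Tendsto (fun i => Function.invFunOn (scaledAngle (ε i)) (Ioi 0) (y i)) l (𝓝 (xiInf ψ)) ∧
      ∀ᶠ i in l, scaledAngle (ε i) (Function.invFunOn (scaledAngle (ε i)) (Ioi 0) (y i)) = y i := by
  have key : ∀ a b, 0 < a → a < xiInf ψ → xiInf ψ < b → ∀ᶠ i in l,
      Function.invFunOn (scaledAngle (ε i)) (Ioi 0) (y i) ∈ Ioo a b ∧
      scaledAngle (ε i) (Function.invFunOn (scaledAngle (ε i)) (Ioi 0) (y i)) = y i := by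
    intro a b ha hax hxb
    have hb : 0 < b := ha.trans (hax.trans hxb)
    have h1 : ∀ᶠ i in l, scaledAngle (ε i) a < y i :=
      ((tendsto_scaledAngle ha).comp hε).eventually_lt hy ((lt_xiInf_iff ha hψ).1 hax)
    have h2 : ∀ᶠ i in l, y i < scaledAngle (ε i) b :=
      hy.eventually_lt ((tendsto_scaledAngle hb).comp hε) ((xiInf_lt_iff hb hψ).1 hxb)
    have h3 : ∀ᶠ i in l, 0 < ε i := hε.eventually self_mem_nhdsWithin
    have h4 : ∀ᶠ i in l, ε i < 1 / 2 :=
      (tendsto_nhds_of_tendsto_nhdsWithin hε).eventually (gt_mem_nhds (by norm_num))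
    filter_upwards [h1, h2, h3, h4] with i h1 h2 h3 h4
    have hc : ContinuousOn (scaledAngle (ε i)) (Icc a b) := fun x hx =>
      (hasDerivAt_scaledAngle h3 h4.le (by linarith [hx.1])).continuousAt.continuousWithinAt
    obtain ⟨x, hx, hxy⟩ := intermediate_value_Ioo (hax.trans hxb).le hc
      (show y i ∈ Ioo _ _ from ⟨h1, h2⟩)
    rw [← hxy, invFunOn_apply_eq (strictMonoOn_scaledAngle h3 h4.le) (ha.trans hx.1)]
    exact ⟨hx, rfl⟩
  have hx := xiInf_pos hψ
  refine ⟨?_, (key _ _ (half_pos hx) (half_lt_self hx) (lt_add_one _)).mono fun _ h => h.2⟩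
  rw [tendsto_order]
  refine ⟨fun a ha => ?_, fun b hb => ?_⟩
  · refine (key (max a (xiInf ψ / 2)) _ (lt_max_of_lt_right (half_pos hx))
      (max_lt ha (half_lt_self hx)) (lt_add_one _)).mono fun _ h => ?_
    exact (le_max_left _ _).trans_lt h.1.1
  · exact (key _ b (half_pos hx) (half_lt_self hx) hb).mono fun _ h => h.1.2

theorem tendsto_angularPart {ψ₀ : ℝ} (hψ : 0 < ψ₀) :
    Tendsto (fun q : ℝ × ℝ => angularPart q.1 (Real.cos (q.2 / √q.1))) (atTop ×ˢ 𝓝 ψ₀)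
      (𝓝 (limitProfile ψ₀)) := by
  set l : Filter (ℝ × ℝ) := atTop ×ˢ 𝓝 ψ₀
  have hs : Tendsto (fun q : ℝ × ℝ => q.1) l atTop := tendsto_fst
  have hψt : Tendsto (fun q : ℝ × ℝ => q.2) l (𝓝 ψ₀) := tendsto_snd
  have hs1 : Tendsto (fun q : ℝ × ℝ => q.1 - 1) l atTop := tendsto_atTop_add_const_right _ (-1) hs
  have hε : Tendsto (fun q : ℝ × ℝ => 1 / (q.1 - 1)) l (𝓝[>] 0) := by
    simpa [Function.comp_def] using tendsto_inv_atTop_nhdsGT_zero.comp hs1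
  have hε0 := tendsto_nhds_of_tendsto_nhdsWithin hε
  have hsinv : Tendsto (fun q : ℝ × ℝ => 1 / q.1) l (𝓝 0) := by
    simpa [Function.comp_def] using tendsto_inv_atTop_zero.comp hs
  -- Since √ε = 1/√(s - 1), the angle ψ/√s is √ε · ψ√(1 - 1/s), so T_ε must be inverted at ψ√(1 -
  -- 1/s).
  have hy : Tendsto (fun q : ℝ × ℝ => q.2 * √(1 - 1 / q.1)) l (𝓝 ψ₀) := by
    have := hψt.mul ((Real.continuous_sqrt.tendsto _).comp (hsinv.const_sub 1))
    simpa using this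
  obtain ⟨hx, hxy⟩ := tendsto_invFunOn_scaledAngle hψ hε hy
  set x : ℝ × ℝ → ℝ := fun q =>
    Function.invFunOn (scaledAngle (1 / (q.1 - 1))) (Ioi 0) (q.2 * √(1 - 1 / q.1))
  have hx0 := xiInf_pos hψ
  have hpair : Tendsto (fun q => (1 / (q.1 - 1), x q)) l (𝓝[>] 0 ×ˢ 𝓝 (xiInf ψ₀)) :=
    hε.prodMk hx
  have hβ := (tendsto_scaledImpact hx0).comp hpair
  have hT' := (tendsto_scaledAngleDeriv hx0).comp hpair
  have hθ : Tendsto (fun q : ℝ × ℝ => √(1 / (q.1 - 1)) * (q.2 * √(1 - 1 / q.1))) l (𝓝 0) := by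
    have := ((Real.continuous_sqrt.tendsto _).comp hε0).mul hy
    simpa using this
  have hsinc := (Real.continuous_sinc.tendsto _).comp hθ
  have h2 : Tendsto (fun q : ℝ × ℝ => (2 : ℝ) ^ (4 * (1 / (q.1 - 1)))) l (𝓝 (2 ^ (4 * 0 : ℝ))) :=
    tendsto_const_nhds.rpow (hε0.const_mul 4) (Or.inl two_ne_zero)
  have hmain := (((h2.mul (hβ.pow 2)).mul ((hy.mul hsinc).inv₀ (by simpa using hψ.ne'))).mul
    (((hε0.const_sub (1 / 2)).div ((hε0.mul hx).const_add 1) (by simp)).add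
      (tendsto_const_nhds (x := (1 : ℝ)).div hx hx0.ne'))).div hT' (psiDeriv_pos hx0.le).ne'
  have hval : (2 : ℝ) ^ (4 * 0 : ℝ) * 1 ^ 2 * (ψ₀ * Real.sinc 0)⁻¹ *
      ((1 / 2 - 0) / (1 + 0 * xiInf ψ₀) + 1 / xiInf ψ₀) / psiDeriv (xiInf ψ₀) = limitProfile ψ₀ := by
    rw [limitProfile_eq hψ]
    have := psiDeriv_pos hx0.le
    simp
    field_simp
    ring
  rw [hval] at hmain
  refine hmain.congr' ?_
  filter_upwards [hxy, hε.eventually self_mem_nhdsWithin, hε0.eventually (gt_mem_nhds one_half_pos),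
    hx.eventually (lt_mem_nhds hx0), hθ.eventually (gt_mem_nhds Real.pi_pos),
    hs.eventually_gt_atTop 1] with q h1 h2 h3 h4 h5 h6
  have h1 : scaledAngle (1 / (q.1 - 1)) (x q) = q.2 * √(1 - 1 / q.1) := h1
  have h7 := angularPart_eq h2 h3.le h4 (by rw [h1]; exact h5.le)
  have h8 : 0 < q.1 - 1 := by linarith
  have h9 : √(1 / (q.1 - 1)) * (q.2 * √(1 - 1 / q.1)) = q.2 / √q.1 := by
    rw [mul_left_comm, ← Real.sqrt_mul (by positivity), div_eq_mul_inv q.2, ← Real.sqrt_inv]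
    congr 2
    field_simp
  rw [one_div_one_div, add_sub_cancel, h1] at h7
  rw [← h9, h7]
  rfl

theorem tendstoLocallyUniformlyOn_angularPart : TendstoLocallyUniformlyOn
    (fun (s ψ : ℝ) => angularPart s (Real.cos (ψ / √s))) limitProfile atTop (Ioi 0) := by
  rw [tendstoLocallyUniformlyOn_iff_forall_tendsto]
  intro ψ₀ hψ
  have h1 : Tendsto (fun q : ℝ × ℝ => limitProfile q.2) (atTop ×ˢ 𝓝 ψ₀)
      (𝓝 (limitProfile ψ₀)) :=
    (analyticOnNhd_limitProfile ψ₀ hψ).continuousAt.tendsto.comp tendsto_snd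
  have h2 := (h1.prodMk_nhds (tendsto_angularPart hψ)).mono_right (nhds_le_uniformity _)
  exact h2.mono_left (prod_mono_right _ nhdsWithin_le_nhds)

end InversePowerLaw

end

theorem theorem2 :
    -- `ψ_∞` is a bijection of `(0, ∞)`, so that its inverse `ξ_∞` and the profile `Φ` make sense
    BijOn InversePowerLaw.psiInf (Ioi 0) (Ioi 0) ∧
    -- locally uniform convergence on `(0, ∞)` of the rescaled angular part
    TendstoLocallyUniformlyOn
      (fun (s ψ : ℝ) => InversePowerLaw.angularPart s (Real.cos (ψ / √s)))
      InversePowerLaw.limitProfile atTop (Ioi 0) ∧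
    -- `Φ` is real analytic on `(0, ∞)`
    AnalyticOnNhd ℝ InversePowerLaw.limitProfile (Ioi 0) ∧
    -- `Φ(ψ) → 1/4` as `ψ → ∞`
    Tendsto InversePowerLaw.limitProfile atTop (𝓝 (1 / 4)) ∧
    -- the singular expansion of `Φ` with remainder continuous up to `0`
    ∃ Φ₀ : ℝ → ℝ, ContinuousOn Φ₀ (Ici 0) ∧
      ∀ ψ : ℝ, 0 < ψ →
        InversePowerLaw.limitProfile ψ = 1 / ψ ^ 2 + 1 / √Real.pi * (1 / ψ) + Φ₀ ψ :=
  ⟨InversePowerLaw.bijOn_psiInf, InversePowerLaw.tendstoLocallyUniformlyOn_angularPart,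
    InversePowerLaw.analyticOnNhd_limitProfile, InversePowerLaw.tendsto_limitProfile_atTop,
    InversePowerLaw.exists_continuousOn_remainder⟩
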